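/- **Setting.** Let $g:\mathbb R^n\to\mathbb R$ and $h:\mathbb R^m\to\mathbb R$ be convex and $C^1$ with $\nabla g$ $L_g$-Lipschitz and $\nabla h$ $L_h$-Lipschitz ($L_g,L_h>0$), let $\varphi:\mathbb R^n\to\mathbb R\cup\{+\infty\}$ and $\psi:\mathbb R^m\to\mathbb R\cup\{+\infty\}$ be proper, lower semicontinuous and convex, and let $h+\psi$ be $\mu$-strongly convex, $\mu>0$. Let $K\in\mathbb R^{n\times m}$, $A\in\mathbb R^{q\times n}$, $B\in\mathbb R^{q\times m}$ with $B\ne0$, $c\in\mathbb R^q$, and let $[A\ B]$ have full row rank. Norms are Euclidean norms and the induced matrix norms. Consider $$\min_x\max_y\ \varphi(x)+g(x)+x^TKy-h(y)-\psi(y)\quad\text{subject to}\quad Ax+By+c=0 .$$ Put $Q(x,y,\lambda)=x^TKy-h(y)-\psi(y)+\langle\lambda,Ax+By+c\rangle$, $\theta_0(x,\lambda)=\sup_yQ(x,y,\lambda)$, $\theta_\varphi=\varphi+g+\theta_0$, and assume $\inf_{x,\lambda}\theta_\varphi(x,\lambda)>-\infty$. For $\alpha>0$ let $\mathrm{prox}_{\alpha\sigma}(z)=\operatorname{argmin}_{z'}\{\alpha\sigma(z')+\frac12\|z'-z\|^2\}$,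 and for $L>0$ let $$G^{\varphi}_L(x,y,\lambda)=L\bigl(x-\mathrm{prox}_{L^{-1}\varphi}(x-L^{-1}(\nabla g(x)+Ky+A^T\lambda))\bigr),$$ $$G^{\psi}_L(x,y,\lambda)=L\bigl(y-\mathrm{prox}_{L^{-1}\psi}(y+L^{-1}(-\nabla h(y)+K^Tx+B^T\lambda))\bigr).$$ A point $(x,y)$ is *$\epsilon$-stationary* if there are $\lambda\in\mathbb R^q$ and $L_1,L_2>0$ with $\|G^\varphi_{L_1}(x,y,\lambda)\|\le\epsilon$, $\|G^\psi_{L_2}(x,y,\lambda)\|\le\epsilon$ and $Ax+By+c=0$. **Method.** Given $\alpha_x,\alpha_y>0$, a number $N\ge1$ of inner steps and a starting point $(x^0,y^0,\lambda^0)$, for $t=0,1,2,\dots$ obtain $y^{t+1}$ from $y^t$ by $N$ steps $y\mapsto\mathrm{prox}_{\alpha_y\psi}[y+\alpha_y(-\nabla h(y)+K^Tx^t+B^T\lambda^t)]$, and set $$x^{t+1}=\mathrm{prox}_{\alpha_x\varphi}[x^t-\alpha_x(\nabla g(x^t)+Ky^{t+1}+A^T\lambda^t)],\qquad \lambda^{t+1}=\lambda^t-\alpha_x(Ax^t+By^{t+1}+c).$$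 Let $(\tilde x^{t},\tilde y^{t})$ be the Euclidean projection of $(x^{t},y^{t})$ onto $\{(x,y):Ax+By+c=0\}$. **Constants.** Let $$\gamma=\max\Bigl\{\sqrt{2(L_g\mu+\|K\|^2)^2+2(\|A\|\mu+\|K\|\|B\|)^2},\ \sqrt{2(\mu\|A\|+\|K\|\|B\|)^2+2\|B\|^4}\Bigr\},\qquad L_\theta=\gamma/\mu,$$ $$\chi_0=\frac1{\alpha_x(1-L_\theta\alpha_x)},\qquad \chi_1=\frac{\|K\|^2+\|B\|^2}{(1-\alpha_xL_\theta)^2},$$ and, with $S=AA^T+BB^T$, $$\omega_x=(L_g+2\alpha_x^{-1})\|A^TS^{-1}\|+\|K\|\|B^TS^{-1}\|,\qquad \omega_y=(L_h+2\alpha_y^{-1})\|B^TS^{-1}\|+\|K\|\|A^TS^{-1}\|,$$ $$\gamma_1=\max\Bigl\{6\Bigl[\tfrac9{\alpha_y^2}+\tfrac{2\mu^2}{\|B\|^2}\chi_1+4\chi_1\omega_y^2\Bigr],\ 8\chi_1\bigl[(1+\alpha_xL_g)^2+3\omega_x^2\bigr]\Bigr\},$$ $$\gamma_2=\max\Bigl\{12\chi_0\Bigl[\tfrac{\mu^2}{\|B\|^2}+2\omega_y^2\Bigr],\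 8\chi_0\bigl[(1+\alpha_xL_g)^2+3\omega_x^2\bigr]\Bigr\}.$$ Let $r=\log(1+\mu\alpha_y)$; if moreover $h$ itself is $\mu$-strongly convex, $r=-\log(1-\mu\alpha_y)$ is also allowed. **Theorem.** Let $0<\alpha_x<1/L_\theta$ and $0<\alpha_y<1/L_h$. For every $\epsilon>0$ and all integers $N,T\ge1$ the following hold. (i) If $\operatorname{dom}\psi\subset\{\|y\|\le\beta_1\}$ with $\beta_1>0$, $\|y^0\|\le\beta_1$, and $$N\ge\frac1r\Bigl[\log(8\gamma_1\beta_1^2)+2\log\frac1\epsilon\Bigr],\qquad T\ge\frac{2\gamma_2(\theta_\varphi(x^0,\lambda^0)-\inf\theta_\varphi)}{\epsilon^2},$$ then there is $t\in\{0,\dots,T-1\}$ with $$\|G^\psi_{\alpha_y^{-1}}(\tilde x^{t+1},\tilde y^{t+1},\lambda^{t+1})\|\le\epsilon,\quad \|G^\varphi_{\alpha_x^{-1}}(\tilde x^{t+1},\tilde y^{t+1},\lambda^{t+1})\|\le\epsilon,\quad A\tilde x^{t+1}+B\tilde y^{t+1}+c=0 .$$ (ii) If $\theta_0(x^t,\lambda^t)-Q(x^t,y^t,\lambda^t)\le\omega_1$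 for $t=0,\dots,T$, with $\omega_1>0$, and $$N\ge\frac1r\Bigl[\log\frac{4\gamma_1\omega_1}{\mu}+2\log\frac1\epsilon\Bigr],\qquad T\ge\frac{2\gamma_2(\theta_\varphi(x^0,\lambda^0)-\inf\theta_\varphi)}{\epsilon^2},$$ then the conclusion of (i) holds. (iii) Consequently, if $x^0\in\operatorname{dom}\varphi$, then in case (i), and likewise in case (ii) for a given $\omega_1$, one can choose $N=N(\epsilon)\ge1$ and $T=T(\epsilon)\ge1$ satisfying the inequalities above for every $\epsilon>0$, with $N(\epsilon)=O(\log\epsilon^{-1})$, $T(\epsilon)=O(\epsilon^{-2})$ and total number of steps $T(\epsilon)(N(\epsilon)+1)=O(\epsilon^{-2}\log\epsilon^{-1})$ as $\epsilon\downarrow0$, such that for every $\epsilon>0$ (in case (ii): provided the inner gaps of the run with $N(\epsilon)$ inner steps are at most $\omega_1$ for $t=0,\dots,T(\epsilon)$) one of the projected iterates $(\tilde x^{t+1},\tilde y^{t+1})$, $0\le t<T(\epsilon)$, is an $\epsilon$-stationary point. -/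

import Mathlib

open Filter Topology Asymptotics

noncomputable section

namespace LCMinimax

/-- Euclidean space of dimension `n`, with the Euclidean norm. -/
abbrev E (n : ℕ) := EuclideanSpace ℝ (Fin n)

/-- The continuous linear map `v ↦ M v` between Euclidean spaces given by a real matrix.
Its operator norm is the matrix norm induced by the Euclidean norms. -/
def act {a b : ℕ} (M : Matrix (Fin a) (Fin b) ℝ) : E b →L[ℝ] E a :=
  LinearMap.toContinuousLinearMap (Matrix.toEuclideanLin M)

/-! ### Extended-real-valued convex analysis

Functions with values in `ℝ ∪ {+∞}` are `EReal`-valued functions that never take the value `⊥`. -/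

/-- Proper: never `-∞`, and not identically `+∞`. -/
def Proper {a : ℕ} (F : E a → EReal) : Prop :=
  (∀ z, F z ≠ ⊥) ∧ ∃ z, F z ≠ ⊤

/-- `F` is strongly convex with modulus `κ`. -/
def StronglyConvex {a : ℕ} (κ : ℝ) (F : E a → EReal) : Prop :=
  ∀ (z w : E a) (s t : ℝ), 0 < s → 0 < t → s + t = 1 →
    F (s • z + t • w) + ((s * t * (κ / 2 * ‖z - w‖ ^ 2) : ℝ) : EReal) ≤
      (s : EReal) * F z + (t : EReal) * F w

/-- Convexity of an extended-real-valued function. -/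
def IsConvex {a : ℕ} (F : E a → EReal) : Prop :=
  ∀ (z w : E a) (s t : ℝ), 0 < s → 0 < t → s + t = 1 →
    F (s • z + t • w) ≤ (s : EReal) * F z + (t : EReal) * F w

/-- `p` minimizes `z' ↦ α σ(z') + ½ ‖z' - z‖²`. -/
def IsProx {a : ℕ} (α : ℝ) (σ : E a → EReal) (z p : E a) : Prop :=
  ∀ z' : E a, (α : EReal) * σ p + ((1 / 2 * ‖p - z‖ ^ 2 : ℝ) : EReal) ≤
    (α : EReal) * σ z' + ((1 / 2 * ‖z' - z‖ ^ 2 : ℝ) : EReal)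

/-- The proximal mapping of `α σ` at `z`: the minimizer of `z' ↦ α σ(z') + ½ ‖z' - z‖²`
(it exists and is unique for `α > 0` and `σ` proper, lower semicontinuous and convex). -/
def prox {a : ℕ} (α : ℝ) (σ : E a → EReal) (z : E a) : E a :=
  Classical.epsilon fun p => IsProx α σ z p

/-! ### The problem -/

/-- The data of `min_x max_y φ(x) + g(x) + xᵀ K y - h(y) - ψ(y)` subject to `A x + B y + c = 0`. -/
structure Problem (n m q : ℕ) where
  φ : E n → EReal
  g : E n → ℝ
  K : Matrix (Fin n) (Fin m) ℝ
  h : E m → ℝ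
  ψ : E m → EReal
  A : Matrix (Fin q) (Fin n) ℝ
  B : Matrix (Fin q) (Fin m) ℝ
  c : E q

/-- The standing regularity assumptions on `g, h, φ, ψ`. -/
structure Assumptions {n m q : ℕ} (P : Problem n m q) (Lg Lh μ : ℝ) : Prop where
  Lg_pos : 0 < Lg
  Lh_pos : 0 < Lh
  μ_pos : 0 < μ
  g_smooth : ContDiff ℝ 1 P.g
  h_smooth : ContDiff ℝ 1 P.h
  g_convex : ConvexOn ℝ Set.univ P.g
  h_convex : ConvexOn ℝ Set.univ P.h
  g_lip : ∀ x x', ‖gradient P.g x' - gradient P.g x‖ ≤ Lg * ‖x' - x‖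
  h_lip : ∀ y y', ‖gradient P.h y' - gradient P.h y‖ ≤ Lh * ‖y' - y‖
  φ_proper : Proper P.φ
  φ_lsc : LowerSemicontinuous P.φ
  φ_convex : IsConvex P.φ
  ψ_proper : Proper P.ψ
  ψ_lsc : LowerSemicontinuous P.ψ
  ψ_convex : IsConvex P.ψ
  strong : StronglyConvex μ fun y => (P.h y : EReal) + P.ψ y

/-- The requirement `N ≥ (log a + 2 log (1 / ε)) / r` on the number of inner steps. -/
def InnerEnough (r a ε : ℝ) (N : ℕ) : Prop :=
  1 / r * (Real.log a + 2 * Real.log (1 / ε)) ≤ (N : ℝ)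

namespace Problem

variable {n m q : ℕ} (P : Problem n m q)

/-- The constraint residual `A x + B y + c`. -/
def resid (x : E n) (y : E m) : E q := act P.A x + act P.B y + P.c

/-- `Q(x, y, l) = xᵀ K y - h(y) - ψ(y) + ⟨l, A x + B y + c⟩`. -/
def Q (x : E n) (y : E m) (l : E q) : EReal :=
  ((inner ℝ x (act P.K y) - P.h y + inner ℝ l (P.resid x y) : ℝ) : EReal) - P.ψ y

/-- `θ₀(x, l) = sup_y Q(x, y, l)`. -/
def θ₀ (x : E n) (l : E q) : EReal := ⨆ y, P.Q x y l

/-- `θ_φ(x, l) = φ(x) + g(x) + θ₀(x, l)`. -/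
def θφ (x : E n) (l : E q) : EReal := P.φ x + (P.g x : EReal) + P.θ₀ x l

/-- The infimum of `θ_φ`. -/
def infθφ : EReal := ⨅ (x : E n) (l : E q), P.θφ x l

/-! ### The algorithm -/

/-- One inner step: a proximal gradient ascent step in `y` for fixed `(x, l)`. -/
def innerStep (αy : ℝ) (x : E n) (l : E q) (y : E m) : E m :=
  prox αy P.ψ (y + αy • (-gradient P.h y + act P.K.transpose x + act P.B.transpose l))

/-- One outer iteration from `(x, y, l)`: `N` inner steps in `y`, then a proximal gradient
descent step in `x` and a gradient descent step in `l`, both with the new `y`. -/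
def outerStep (αx αy : ℝ) (N : ℕ) (s : E n × E m × E q) : E n × E m × E q :=
  let x := s.1
  let l := s.2.2
  let y' := (P.innerStep αy x l)^[N] s.2.1
  (prox αx P.φ (x - αx • (gradient P.g x + act P.K y' + act P.A.transpose l)),
    y', l - αx • P.resid x y')

/-- The iterate `(x^t, y^t, l^t)` of the method started at `s₀ = (x⁰, y⁰, l⁰)`. -/
def iter (αx αy : ℝ) (N : ℕ) (s₀ : E n × E m × E q) (t : ℕ) : E n × E m × E q :=
  (P.outerStep αx αy N)^[t] s₀

/-- `w` is a nearest point to `z` in `C = {(x, y) : A x + B y + c = 0}`, for the Euclidean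
distance of `ℝⁿ × ℝᵐ`. -/
def IsProjC (z w : E n × E m) : Prop :=
  P.resid w.1 w.2 = 0 ∧ ∀ u : E n × E m, P.resid u.1 u.2 = 0 →
    ‖z.1 - w.1‖ ^ 2 + ‖z.2 - w.2‖ ^ 2 ≤ ‖z.1 - u.1‖ ^ 2 + ‖z.2 - u.2‖ ^ 2

/-- The Euclidean projection onto `C`. -/
def projC (z : E n × E m) : E n × E m := Classical.epsilon fun w => P.IsProjC z w

/-- The projected iterate, the projection onto `C` of `(x^t, y^t)`. -/
def projIter (αx αy : ℝ) (N : ℕ) (s₀ : E n × E m × E q) (t : ℕ) : E n × E m :=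
  P.projC ((P.iter αx αy N s₀ t).1, (P.iter αx αy N s₀ t).2.1)

/-! ### Stationarity -/

/-- The gradient mapping in `x`. -/
def Gφ (L : ℝ) (x : E n) (y : E m) (l : E q) : E n :=
  L • (x - prox L⁻¹ P.φ (x - L⁻¹ • (gradient P.g x + act P.K y + act P.A.transpose l)))

/-- The gradient mapping in `y`. -/
def Gψ (L : ℝ) (x : E n) (y : E m) (l : E q) : E m :=
  L • (y - prox L⁻¹ P.ψ
    (y + L⁻¹ • (-gradient P.h y + act P.K.transpose x + act P.B.transpose l)))

/-- The three conditions of `ε`-stationarity for a given multiplier `l` and given `L₁, L₂`. -/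
def EpsStationaryWith (ε L₁ L₂ : ℝ) (x : E n) (y : E m) (l : E q) : Prop :=
  ‖P.Gφ L₁ x y l‖ ≤ ε ∧ ‖P.Gψ L₂ x y l‖ ≤ ε ∧ P.resid x y = 0

/-- `(x, y)` is an `ε`-stationary point. -/
def IsEpsStationary (ε : ℝ) (x : E n) (y : E m) : Prop :=
  ∃ (l : E q) (L₁ L₂ : ℝ), 0 < L₁ ∧ 0 < L₂ ∧ P.EpsStationaryWith ε L₁ L₂ x y l

/-! ### Constants -/

/-- `γ`. -/
def γ (Lg μ : ℝ) : ℝ :=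
  max
    (Real.sqrt (2 * (Lg * μ + ‖act P.K‖ ^ 2) ^ 2 + 2 * (‖act P.A‖ * μ + ‖act P.K‖ * ‖act P.B‖) ^ 2))
    (Real.sqrt (2 * (μ * ‖act P.A‖ + ‖act P.K‖ * ‖act P.B‖) ^ 2 + 2 * ‖act P.B‖ ^ 4))

/-- `L_θ = γ / μ`. -/
def Lθ (Lg μ : ℝ) : ℝ := P.γ Lg μ / μ

/-- `χ₀ = 1 / (α_x (1 - L_θ α_x))`. -/
def χ₀ (Lg μ αx : ℝ) : ℝ := 1 / (αx * (1 - P.Lθ Lg μ * αx))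

/-- `χ₁ = (‖K‖² + ‖B‖²) / (1 - α_x L_θ)²`. -/
def χ₁ (Lg μ αx : ℝ) : ℝ := (‖act P.K‖ ^ 2 + ‖act P.B‖ ^ 2) / (1 - αx * P.Lθ Lg μ) ^ 2

/-- `‖Aᵀ (A Aᵀ + B Bᵀ)⁻¹‖`. -/
def normA : ℝ :=
  ‖act (P.A.transpose * (P.A * P.A.transpose + P.B * P.B.transpose)⁻¹)‖

/-- `‖Bᵀ (A Aᵀ + B Bᵀ)⁻¹‖`. -/
def normB : ℝ :=
  ‖act (P.B.transpose * (P.A * P.A.transpose + P.B * P.B.transpose)⁻¹)‖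

/-- `ω_x`. -/
def ωx (Lg αx : ℝ) : ℝ := (Lg + 2 * αx⁻¹) * P.normA + ‖act P.K‖ * P.normB

/-- `ω_y`. -/
def ωy (Lh αy : ℝ) : ℝ := (Lh + 2 * αy⁻¹) * P.normB + ‖act P.K‖ * P.normA

/-- `γ₁`. -/
def γ₁ (Lg Lh μ αx αy : ℝ) : ℝ :=
  max
    (6 * (9 / αy ^ 2 + 2 * μ ^ 2 / ‖act P.B‖ ^ 2 * P.χ₁ Lg μ αx
      + 4 * P.χ₁ Lg μ αx * P.ωy Lh αy ^ 2))
    (8 * P.χ₁ Lg μ αx * ((1 + αx * Lg) ^ 2 + 3 * P.ωx Lg αx ^ 2))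

/-- `γ₂`. -/
def γ₂ (Lg Lh μ αx αy : ℝ) : ℝ :=
  max
    (12 * P.χ₀ Lg μ αx * (μ ^ 2 / ‖act P.B‖ ^ 2 + 2 * P.ωy Lh αy ^ 2))
    (8 * P.χ₀ Lg μ αx * ((1 + αx * Lg) ^ 2 + 3 * P.ωx Lg αx ^ 2))

/-- The admissible exponential rates of the inner loop: `log (1 + μ α_y)` always, and also
`-log (1 - μ α_y)` when the strong convexity is carried by the smooth part `h` alone. -/
def IsInnerRate (μ αy r : ℝ) : Prop :=
  r = Real.log (1 + μ * αy) ∨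
    (StrongConvexOn Set.univ μ P.h ∧ r = -Real.log (1 - μ * αy))

/-- The requirement `T ≥ 2 γ₂ (θ_φ(x⁰, l⁰) - inf θ_φ) / ε²` on the number of outer iterations
(it fails for every `T` when `θ_φ(x⁰, l⁰) = +∞`). -/
def OuterEnough (Lg Lh μ αx αy ε : ℝ) (s₀ : E n × E m × E q) (T : ℕ) : Prop :=
  ((2 * P.γ₂ Lg Lh μ αx αy / ε ^ 2 : ℝ) : EReal) * (P.θφ s₀.1 s₀.2.2 - P.infθφ)
    ≤ ((T : ℝ) : EReal)

/-- The inner gaps `θ₀(x^t, l^t) - Q(x^t, y^t, l^t)`, `t = 0, …, T`, are at most `ω₁`. -/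
def GapsBounded (αx αy : ℝ) (N : ℕ) (s₀ : E n × E m × E q) (T : ℕ) (ω₁ : ℝ) : Prop :=
  ∀ t ≤ T,
    P.θ₀ (P.iter αx αy N s₀ t).1 (P.iter αx αy N s₀ t).2.2
      - P.Q (P.iter αx αy N s₀ t).1 (P.iter αx αy N s₀ t).2.1 (P.iter αx αy N s₀ t).2.2
    ≤ (ω₁ : EReal)

end Problem

/-- The numbers of inner steps `N(ε)` and outer iterations `T(ε)` are `O(log ε⁻¹)` and `O(ε⁻²)`,
and the total number `T (N + 1)` of steps of the method (`N` inner steps and one `(x, l)`-step per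
outer iteration) is `O(ε⁻² log ε⁻¹)`, as `ε` decreases to `0`. -/
def ComplexityBounds (N T : ℝ → ℕ) : Prop :=
  ((fun ε => (N ε : ℝ)) =O[𝓝[>] (0 : ℝ)] fun ε => Real.log ε⁻¹) ∧
  ((fun ε => (T ε : ℝ)) =O[𝓝[>] (0 : ℝ)] fun ε => ε⁻¹ ^ 2) ∧
  ((fun ε => (T ε : ℝ) * ((N ε : ℝ) + 1)) =O[𝓝[>] (0 : ℝ)] fun ε => ε⁻¹ ^ 2 * Real.log ε⁻¹)

end LCMinimax

end

/-!
For fixed `(x, l)` the function `Q(x, ·, l)` is strongly concave, so it has a unique maximizer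
`y*(x, l)`, and `Q(x, y, l) + μ/2 ‖y - y*‖² ≤ θ₀(x, l)` on the domain of `ψ`
(`exists_strong_minimizer`, `Problem.best_spec`). The method is an inexact proximal gradient
descent for `θ_φ = φ + (g + θ₀)` in `(x, l)`, in which the inner loop replaces `y*` by an
approximation.

* Inner loop. One proximal gradient step multiplies the squared distance to `y*` by at most
  `(1 - κ α_y) / (1 + μ α_y)`, where `κ` is the modulus of `h` itself (`κ = 0` always works). Hence
  `N` steps multiply it by at most `exp (-r N)` (`Problem.innerLoop_contract`), and the initial
  distance is bounded either by the diameter of the domain of `ψ` or through the inner gap.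
* Outer loop. Comparing the values of `Q` at the best responses of two points `(x, l)`, `(x', l')`
  shows that `g + θ₀` satisfies the descent lemma with constant `L_θ`
  (`Problem.smooth_part_descent`); no differentiability of `θ₀` is needed. With the prox inequality
  for `φ`, the scaled squared step `U_t = ‖(x, l)^{t+1} - (x, l)^t‖² / α_x²` satisfies
  `U_t ≤ 2 χ₀ (θ_φ^t - θ_φ^{t+1}) + χ₁ ‖y^{t+1} - y*‖²` (`Problem.outer_descent`).
* Stationarity. The projection onto the constraint set subtracts
  `(Aᵀ S⁻¹ r, Bᵀ S⁻¹ r)` from `(x, y)` (`Problem.projC_eq`), and the residual `r` is of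
  the size of the last step, so nonexpansiveness of the proximal maps bounds both gradient mappings
  at the projected point by `U_t` and `‖y^{t+1} - y*‖²` (`Problem.gradient_mappings_sq_le`).

Summing the descent inequality over `t < T` and taking `t` with `U_t` at most the average gives a
single `t` for which both gradient mappings are small (`Problem.exists_epsStationary`).
-/

noncomputable section

namespace LCMinimax

/-! ### Strongly convex minimization and proximal points -/

theorem IsConvex.toReal_le {a : ℕ} {σ : E a → EReal} (hp : Proper σ) (hc : IsConvex σ)
    {z w : E a} {s t : ℝ} (hs : 0 < s) (ht : 0 < t) (hst : s + t = 1)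
    (hz : σ z ≠ ⊤) (hw : σ w ≠ ⊤) :
    σ (s • z + t • w) ≠ ⊤ ∧
      (σ (s • z + t • w)).toReal ≤ s * (σ z).toReal + t * (σ w).toReal := by
  have h := hc z w s t hs ht hst
  rw [← EReal.coe_toReal hz (hp.1 z), ← EReal.coe_toReal hw (hp.1 w), ← EReal.coe_mul,
    ← EReal.coe_mul, ← EReal.coe_add] at h
  have h1 : σ (s • z + t • w) ≠ ⊤ := ne_top_of_le_ne_top (EReal.coe_ne_top _) h
  refine ⟨h1, ?_⟩
  rw [← EReal.coe_toReal h1 (hp.1 _)] at h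
  exact EReal.coe_le_coe_iff.1 h

/-- A function that attains its minimum over a set of the form `dom σ`, where it is strongly convex
with modulus `κ`, grows quadratically away from the minimizer. The function is `σ + k` with `k`
real-valued and continuous; strong convexity is stated for its real values on `dom σ`. -/
theorem exists_strong_minimizer {a : ℕ} {σ : E a → EReal} (hp : Proper σ)
    (hl : LowerSemicontinuous σ) {k : E a → ℝ} (hk : Continuous k) {κ : ℝ} (hκ : 0 < κ)
    (hsc : ∀ (z w : E a) (s t : ℝ), 0 < s → 0 < t → s + t = 1 → σ z ≠ ⊤ → σ w ≠ ⊤ →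
      σ (s • z + t • w) ≠ ⊤ ∧
      (σ (s • z + t • w)).toReal + k (s • z + t • w) + s * t * (κ / 2 * ‖z - w‖ ^ 2) ≤
        s * ((σ z).toReal + k z) + t * ((σ w).toReal + k w)) :
    ∃ p, σ p ≠ ⊤ ∧ ∀ z, σ z ≠ ⊤ →
      (σ p).toReal + k p + κ / 2 * ‖z - p‖ ^ 2 ≤ (σ z).toReal + k z := by
  set f : E a → ℝ := fun z => (σ z).toReal + k z with hf
  obtain ⟨z₀, hz₀⟩ := hp.2
  have hF : ∀ z, σ z ≠ ⊤ → σ z + (k z : EReal) = (f z : EReal) := by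
    intro z hz
    rw [hf, EReal.coe_add, EReal.coe_toReal hz (hp.1 z)]
  have hlsc : LowerSemicontinuous fun z => σ z + (k z : EReal) := by
    refine LowerSemicontinuous.add' hl
      (continuous_coe_real_ereal.comp hk).lowerSemicontinuous fun x => ?_
    exact EReal.continuousAt_add (Or.inr (EReal.coe_ne_bot _)) (Or.inl (hp.1 x))
  have hball : ∀ R : ℝ, 0 ≤ R → ∃ p ∈ Metric.closedBall z₀ R, σ p ≠ ⊤ ∧
      ∀ z ∈ Metric.closedBall z₀ R, σ z ≠ ⊤ → f p ≤ f z := by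
    intro R hR
    obtain ⟨p, hpR, hmin⟩ := (hlsc.lowerSemicontinuousOn _).exists_isMinOn
      (s := Metric.closedBall z₀ R) ⟨z₀, Metric.mem_closedBall_self hR⟩
      (isCompact_closedBall z₀ R)
    have hp0 : σ p ≠ ⊤ := by
      intro htop
      have := hmin (Metric.mem_closedBall_self hR)
      simp only [Set.mem_ofPred_eq, htop, EReal.top_add_coe, hF z₀ hz₀, top_le_iff] at this
      exact EReal.coe_ne_top _ this
    refine ⟨p, hpR, hp0, fun z hz hzt => ?_⟩
    have := hmin hz
    simp only [Set.mem_ofPred_eq, hF p hp0, hF z hzt] at this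
    exact EReal.coe_le_coe_iff.1 this
  obtain ⟨p₁, -, -, h₁⟩ := hball 1 zero_le_one
  have hle₁ : f p₁ ≤ f z₀ := h₁ z₀ (Metric.mem_closedBall_self zero_le_one) hz₀
  -- Beyond this radius the quadratic term of strong convexity pushes `f` above `f z₀`.
  set R₀ : ℝ := 1 + 2 * (f z₀ - f p₁) / κ with hR₀
  have hR₀1 : 1 ≤ R₀ := by
    have : 0 ≤ 2 * (f z₀ - f p₁) / κ := div_nonneg (by linarith) hκ.le
    linarith
  obtain ⟨p, -, hp0, hpmin⟩ := hball R₀ (by linarith)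
  have hglob : ∀ z, σ z ≠ ⊤ → f p ≤ f z := by
    intro z hz
    by_cases hzR : ‖z - z₀‖ ≤ R₀
    · exact hpmin z (by rwa [mem_closedBall_iff_norm]) hz
    refine (hpmin z₀ (Metric.mem_closedBall_self (by linarith)) hz₀).trans ?_
    push Not at hzR
    set R := ‖z - z₀‖ with hR
    have hR1 : 1 < R := by linarith
    have hRpos : 0 < R := by linarith
    have hs : 0 < 1 - 1 / R := by
      rw [sub_pos, div_lt_one hRpos]; exact hR1
    have ht : 0 < 1 / R := by positivity
    obtain ⟨hw, hwle⟩ := hsc z₀ z (1 - 1 / R) (1 / R) hs ht (by ring) hz₀ hz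
    have hwmem : (1 - 1 / R) • z₀ + (1 / R) • z ∈ Metric.closedBall z₀ 1 := by
      rw [mem_closedBall_iff_norm]
      have : (1 - 1 / R) • z₀ + (1 / R) • z - z₀ = (1 / R) • (z - z₀) := by module
      rw [this, norm_smul, ← hR, Real.norm_of_nonneg ht.le, one_div,
        inv_mul_cancel₀ hRpos.ne']
    have hw2 := h₁ _ hwmem hw
    have hn : ‖z₀ - z‖ = R := by rw [norm_sub_rev]
    rw [hn] at hwle
    change f _ + _ ≤ _ * f z₀ + _ * f z at hwle
    have e : (1 - 1 / R) * (1 / R) * (κ / 2 * R ^ 2) = (R - 1) * (κ / 2) := by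
      field_simp
    rw [e] at hwle
    have h2 : f z₀ - f p₁ ≤ (R - 1) * (κ / 2) := by
      have : 2 * (f z₀ - f p₁) / κ ≤ R - 1 := by linarith
      rw [div_le_iff₀ hκ] at this
      linarith
    have h3 : (1 / R) * f z₀ ≤ (1 / R) * f z := by linarith
    exact le_of_mul_le_mul_left h3 ht
  refine ⟨p, hp0, fun z hz => ?_⟩
  change f p + _ ≤ f z
  have key : ∀ t ∈ Set.Ioo (0 : ℝ) 1, f p + (1 - t) * (κ / 2 * ‖z - p‖ ^ 2) ≤ f z := by
    rintro t ⟨ht0, ht1⟩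
    obtain ⟨hw, hle⟩ := hsc p z (1 - t) t (by linarith) ht0 (by ring) hp0 hz
    have h1 := hglob _ hw
    change f _ + _ ≤ _ * f p + _ * f z at hle
    rw [norm_sub_rev] at hle
    have : t * (f p + (1 - t) * (κ / 2 * ‖z - p‖ ^ 2)) ≤ t * f z := by linarith
    exact le_of_mul_le_mul_left this ht0
  have hlim : Tendsto (fun t : ℝ => f p + (1 - t) * (κ / 2 * ‖z - p‖ ^ 2)) (𝓝[>] 0)
      (𝓝 (f p + (1 - 0) * (κ / 2 * ‖z - p‖ ^ 2))) :=
    ((by fun_prop : Continuous fun t : ℝ => f p + (1 - t) * (κ / 2 * ‖z - p‖ ^ 2)).tendsto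
      0).mono_left nhdsWithin_le_nhds
  rw [sub_zero, one_mul] at hlim
  exact le_of_tendsto hlim (by
    filter_upwards [Ioo_mem_nhdsGT (zero_lt_one' ℝ)] with t ht using key t ht)

/-- `‖s z + t w‖² = s ‖z‖² + t ‖w‖² - s t ‖z - w‖²` for `s + t = 1`. -/
theorem norm_sq_convex_comb {a : ℕ} (z w : E a) {s t : ℝ} (hst : s + t = 1) :
    ‖s • z + t • w‖ ^ 2 = s * ‖z‖ ^ 2 + t * ‖w‖ ^ 2 - s * t * ‖z - w‖ ^ 2 := by
  rw [norm_add_sq_real, norm_sub_sq_real, norm_smul, norm_smul, inner_smul_left, inner_smul_right,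
    mul_pow, mul_pow, Real.norm_eq_abs, Real.norm_eq_abs, sq_abs, sq_abs]
  obtain rfl : t = 1 - s := by linarith
  simp only [conj_trivial]
  ring

/-- The three-point inequality of the proximal point. It also shows that the proximal point chosen
by `Classical.epsilon` exists and lies in the domain of `σ`. -/
theorem prox_spec {a : ℕ} {σ : E a → EReal} (hp : Proper σ) (hl : LowerSemicontinuous σ)
    (hc : IsConvex σ) {α : ℝ} (hα : 0 < α) (z : E a) :
    σ (prox α σ z) ≠ ⊤ ∧ ∀ u, σ u ≠ ⊤ →
      α * (σ (prox α σ z)).toReal + 1 / 2 * ‖prox α σ z - z‖ ^ 2 + 1 / 2 * ‖u - prox α σ z‖ ^ 2 ≤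
        α * (σ u).toReal + 1 / 2 * ‖u - z‖ ^ 2 := by
  have hval : ∀ u, σ u ≠ ⊤ → (α : EReal) * σ u + ((1 / 2 * ‖u - z‖ ^ 2 : ℝ) : EReal) =
      ((α * (σ u).toReal + 1 / 2 * ‖u - z‖ ^ 2 : ℝ) : EReal) := by
    intro u hu
    rw [EReal.coe_add (α * _), EReal.coe_mul α, EReal.coe_toReal hu (hp.1 u)]
  have htop : ∀ u, σ u = ⊤ → (α : EReal) * σ u + ((1 / 2 * ‖u - z‖ ^ 2 : ℝ) : EReal) = ⊤ := by
    intro u hu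
    rw [hu, EReal.coe_mul_top_of_pos hα, EReal.top_add_coe]
  obtain ⟨p, hp0, hpmin⟩ := exists_strong_minimizer hp hl
    (k := fun u => 1 / (2 * α) * ‖u - z‖ ^ 2) (by fun_prop) (κ := 1 / α) (by positivity) (by
      intro u w s t hs ht hst hu hw
      obtain ⟨h1, h2⟩ := hc.toReal_le hp hs ht hst hu hw
      refine ⟨h1, ?_⟩
      have e : s • u + t • w - z = s • (u - z) + t • (w - z) := by
        have : z = (s + t) • z := by rw [hst, one_smul]
        nth_rw 1 [this]
        module
      rw [e, norm_sq_convex_comb _ _ hst, sub_sub_sub_cancel_right]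
      have e2 : 1 / α / 2 = 1 / (2 * α) := by field_simp
      rw [e2]
      linarith)
  have hstrong : ∀ u, σ u ≠ ⊤ → α * (σ p).toReal + 1 / 2 * ‖p - z‖ ^ 2 + 1 / 2 * ‖u - p‖ ^ 2 ≤
      α * (σ u).toReal + 1 / 2 * ‖u - z‖ ^ 2 := by
    intro u hu
    have h := mul_le_mul_of_nonneg_left (hpmin u hu) hα.le
    have e1 : α * ((σ p).toReal + 1 / (2 * α) * ‖p - z‖ ^ 2 + 1 / α / 2 * ‖u - p‖ ^ 2) =
      α * (σ p).toReal + 1 / 2 * ‖p - z‖ ^ 2 + 1 / 2 * ‖u - p‖ ^ 2 := by field_simp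
    have e2 : α * ((σ u).toReal + 1 / (2 * α) * ‖u - z‖ ^ 2) =
      α * (σ u).toReal + 1 / 2 * ‖u - z‖ ^ 2 := by field_simp
    linarith
  have hex : IsProx α σ z p := by
    intro u
    by_cases hu : σ u = ⊤
    · rw [htop u hu]; exact le_top
    · rw [hval u hu, hval p hp0, EReal.coe_le_coe_iff]
      have := hstrong u hu
      have h0 : 0 ≤ 1 / 2 * ‖u - p‖ ^ 2 := by positivity
      linarith
  have hspec : IsProx α σ z (prox α σ z) := Classical.epsilon_spec ⟨p, hex⟩
  have hne : σ (prox α σ z) ≠ ⊤ := by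
    intro h
    have := hspec p
    rw [htop _ h, hval p hp0, top_le_iff] at this
    exact EReal.coe_ne_top _ this
  have heq : prox α σ z = p := by
    have h1 := hspec p
    rw [hval _ hne, hval p hp0, EReal.coe_le_coe_iff] at h1
    have h2 := hstrong _ hne
    have h3 : ‖prox α σ z - p‖ ^ 2 ≤ 0 := by linarith
    have h4 : ‖prox α σ z - p‖ = 0 := by
      have := sq_nonneg ‖prox α σ z - p‖
      exact pow_eq_zero_iff two_ne_zero |>.1 (le_antisymm h3 this)
    exact sub_eq_zero.1 (norm_eq_zero.1 h4)
  rw [heq]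
  exact ⟨hp0, hstrong⟩

theorem prox_nonexpansive {a : ℕ} {σ : E a → EReal} (hp : Proper σ) (hl : LowerSemicontinuous σ)
    (hc : IsConvex σ) {α : ℝ} (hα : 0 < α) (z w : E a) :
    ‖prox α σ z - prox α σ w‖ ≤ ‖z - w‖ := by
  obtain ⟨h1, h2⟩ := prox_spec hp hl hc hα z
  obtain ⟨h3, h4⟩ := prox_spec hp hl hc hα w
  have h5 := h2 _ h3
  have h6 := h4 _ h1
  generalize prox α σ z = p at *
  generalize prox α σ w = r at *
  have key : ‖p - r‖ ^ 2 ≤ inner ℝ (p - r) (z - w) := by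
    have e : inner ℝ (p - r) (z - w) =
        1 / 2 * (‖r - z‖ ^ 2 + ‖p - w‖ ^ 2 - ‖p - z‖ ^ 2 - ‖r - w‖ ^ 2) := by
      simp only [norm_sub_sq_real, inner_sub_left, inner_sub_right]
      ring
    rw [e]
    rw [norm_sub_rev r p] at h5
    linarith
  have h7 := key.trans (real_inner_le_norm _ _)
  rcases (norm_nonneg (p - r)).eq_or_lt with h0 | h0
  · rw [← h0]; exact norm_nonneg _
  · rw [sq] at h7
    exact le_of_mul_le_mul_left h7 h0

/-! ### Gradient inequalities and the proximal gradient step -/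

theorem hasDerivAt_line {a : ℕ} {h : E a → ℝ} (hd : Differentiable ℝ h) (y d : E a) (t : ℝ) :
    HasDerivAt (fun t : ℝ => h (y + t • d)) (inner ℝ (gradient h (y + t • d)) d) t := by
  have h1 : HasFDerivAt h _ (y + t • d) := (hd (y + t • d)).hasGradientAt.hasFDerivAt
  have h2 : HasDerivAt (fun t : ℝ => y + t • d) d t := by
    simpa using ((hasDerivAt_id t).smul_const d).const_add y
  exact h1.comp_hasDerivAt t h2

/-- The descent lemma: a quadratic upper bound for a function with Lipschitz gradient. -/
theorem descent_lemma {a : ℕ} {h : E a → ℝ} (hd : Differentiable ℝ h) {L : ℝ}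
    (hlip : ∀ y y', ‖gradient h y' - gradient h y‖ ≤ L * ‖y' - y‖) (y y' : E a) :
    h y' ≤ h y + inner ℝ (gradient h y) (y' - y) + L / 2 * ‖y' - y‖ ^ 2 := by
  set d := y' - y with hdd
  let F : ℝ → ℝ := fun t =>
    h (y + t • d) - t * inner ℝ (gradient h y) d - L / 2 * t ^ 2 * ‖d‖ ^ 2
  have hF : ∀ t, HasDerivAt F (inner ℝ (gradient h (y + t • d)) d - inner ℝ (gradient h y) d
      - L * t * ‖d‖ ^ 2) t := by
    intro t
    have h1 := hasDerivAt_line hd y d t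
    have h2 := (hasDerivAt_id t).mul_const (inner ℝ (gradient h y) d)
    have h3 := (((hasDerivAt_id t).pow 2).const_mul (L / 2)).mul_const (‖d‖ ^ 2)
    refine ((h1.sub h2).sub h3).congr_deriv ?_
    simp only [Nat.cast_ofNat, id_eq, Nat.add_one_sub_one, pow_one, mul_one, one_mul]
    ring
  have hanti : AntitoneOn F (Set.Ici 0) := by
    refine antitoneOn_of_deriv_nonpos (convex_Ici 0)
      (fun t _ => (hF t).continuousAt.continuousWithinAt)
      (fun t _ => (hF t).differentiableAt.differentiableWithinAt) fun t ht => ?_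
    rw [interior_Ici, Set.mem_Ioi] at ht
    rw [(hF t).deriv, ← inner_sub_left]
    have h1 := real_inner_le_norm (gradient h (y + t • d) - gradient h y) d
    have h2 := hlip y (y + t • d)
    rw [add_sub_cancel_left, norm_smul, Real.norm_of_nonneg ht.le] at h2
    have h3 := mul_le_mul_of_nonneg_right h2 (norm_nonneg d)
    nlinarith
  have h01 := hanti (Set.self_mem_Ici) (Set.mem_Ici.2 zero_le_one) (zero_le_one' ℝ)
  simp only [F, one_smul, zero_smul, add_zero, hdd, add_sub_cancel] at h01
  linarith

/-- The gradient inequality for a strongly convex differentiable function. -/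
theorem gradient_inequality {a : ℕ} {h : E a → ℝ} (hd : Differentiable ℝ h) {κ : ℝ}
    (hc : StrongConvexOn Set.univ κ h) (y y' : E a) :
    h y + inner ℝ (gradient h y) (y' - y) + κ / 2 * ‖y' - y‖ ^ 2 ≤ h y' := by
  set d := y' - y with hdd
  have hder := (hasDerivAt_line hd y d 0).tendsto_slope_zero_right
  simp only [zero_add, zero_smul, add_zero] at hder
  have hlim : Tendsto (fun t : ℝ => h y' - h y - (1 - t) * (κ / 2 * ‖d‖ ^ 2)) (𝓝[>] 0)
      (𝓝 (h y' - h y - (1 - 0) * (κ / 2 * ‖d‖ ^ 2))) :=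
    ((by fun_prop : Continuous fun t : ℝ =>
      h y' - h y - (1 - t) * (κ / 2 * ‖d‖ ^ 2)).tendsto 0).mono_left nhdsWithin_le_nhds
  have := le_of_tendsto_of_tendsto hder hlim (by
    filter_upwards [Ioo_mem_nhdsGT (zero_lt_one' ℝ)] with t ht
    obtain ⟨ht0, ht1⟩ := ht
    have h1 := hc.2 (Set.mem_univ y) (Set.mem_univ y') (sub_nonneg.2 ht1.le) ht0.le (by ring)
    have e : (1 - t) • y + t • y' = y + t • d := by rw [hdd]; module
    rw [e, norm_sub_rev, ← hdd] at h1
    simp only [smul_eq_mul] at h1 ⊢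
    rw [inv_mul_le_iff₀ ht0]
    linarith)
  linarith

/-- A proximal gradient step for the minimization of `h + σ - ⟨v, ·⟩`, compared with any point of
the domain of `σ`. -/
theorem prox_gradient_step {a : ℕ} {σ : E a → EReal} (hp : Proper σ) (hl : LowerSemicontinuous σ)
    (hc : IsConvex σ) {h : E a → ℝ} (hd : Differentiable ℝ h) {L κ : ℝ}
    (hlip : ∀ y y', ‖gradient h y' - gradient h y‖ ≤ L * ‖y' - y‖)
    (hsc : StrongConvexOn Set.univ κ h) {α : ℝ} (hα : 0 < α) (hαL : α * L ≤ 1)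
    (v y u : E a) (hu : σ u ≠ ⊤) {y' : E a} (hy' : y' = prox α σ (y + α • (-gradient h y + v))) :
    α * (h y' + (σ y').toReal - inner ℝ v y') + 1 / 2 * ‖u - y'‖ ^ 2 ≤
      α * (h u + (σ u).toReal - inner ℝ v u) + 1 / 2 * (1 - α * κ) * ‖u - y‖ ^ 2 := by
  have h1 := (prox_spec hp hl hc hα (y + α • (-gradient h y + v))).2 u hu
  rw [← hy'] at h1
  have h2 := descent_lemma hd hlip y y'
  have h3 := gradient_inequality hd hsc y u
  have e1 : ∀ x : E a, ‖x - (y + α • (-gradient h y + v))‖ ^ 2 =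
      ‖x - y‖ ^ 2 - 2 * α * (inner ℝ v (x - y) - inner ℝ (gradient h y) (x - y)) +
        ‖α • (-gradient h y + v)‖ ^ 2 := by
    intro x
    rw [← sub_sub, norm_sub_sq_real, inner_smul_right, inner_add_right, inner_neg_right,
      real_inner_comm, real_inner_comm v]
    ring
  rw [e1, e1, inner_sub_right v, inner_sub_right v] at h1
  have h4 := mul_le_mul_of_nonneg_left h2 hα.le
  have h5 := mul_le_mul_of_nonneg_left h3 hα.le
  have h6 : α * L * ‖y' - y‖ ^ 2 ≤ 1 * ‖y' - y‖ ^ 2 := by gcongr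
  linarith

/-- If `h` is `μ`-strongly convex with `L`-Lipschitz gradient on a nontrivial space, `μ ≤ L`. -/
theorem strong_modulus_le {a : ℕ} {h : E a → ℝ} (hd : Differentiable ℝ h) {L κ : ℝ}
    (hlip : ∀ y y', ‖gradient h y' - gradient h y‖ ≤ L * ‖y' - y‖)
    (hsc : StrongConvexOn Set.univ κ h) {d : E a} (hd0 : d ≠ 0) : κ ≤ L := by
  have h2 := descent_lemma hd hlip 0 d
  have h3 := gradient_inequality hd hsc 0 d
  have h4 : κ / 2 * ‖d - 0‖ ^ 2 ≤ L / 2 * ‖d - 0‖ ^ 2 := by linarith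
  rw [sub_zero] at h4
  have h5 : 0 < ‖d‖ ^ 2 := by positivity
  have := le_of_mul_le_mul_right h4 h5
  linarith

/-! ### Matrices acting on Euclidean spaces -/

theorem act_apply {a b : ℕ} (M : Matrix (Fin a) (Fin b) ℝ) (v : E b) :
    act M v = WithLp.toLp 2 (M.mulVec v.ofLp) := rfl

theorem inner_act {a b : ℕ} (M : Matrix (Fin a) (Fin b) ℝ) (x : E a) (y : E b) :
    inner ℝ x (act M y) = inner ℝ (act M.transpose x) y := by
  simp only [act_apply, EuclideanSpace.inner_eq_star_dotProduct, star_trivial]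
  rw [Matrix.mulVec_transpose, dotProduct_comm, Matrix.dotProduct_mulVec, dotProduct_comm]

theorem act_mul {a b d : ℕ} (M : Matrix (Fin a) (Fin b) ℝ) (M' : Matrix (Fin b) (Fin d) ℝ)
    (v : E d) : act (M * M') v = act M (act M' v) := by
  simp [act_apply, Matrix.mulVec_mulVec]

theorem norm_act_transpose_apply_le {a b : ℕ} (M : Matrix (Fin a) (Fin b) ℝ) (x : E a) :
    ‖act M.transpose x‖ ≤ ‖act M‖ * ‖x‖ := by
  rcases (norm_nonneg (act M.transpose x)).eq_or_lt with h | h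
  · rw [← h]; positivity
  have h1 : ‖act M.transpose x‖ * ‖act M.transpose x‖ ≤
      (‖act M‖ * ‖x‖) * ‖act M.transpose x‖ := by
    rw [← real_inner_self_eq_norm_mul_norm, ← inner_act]
    calc inner ℝ x (act M (act M.transpose x)) ≤ ‖x‖ * ‖act M (act M.transpose x)‖ :=
          real_inner_le_norm _ _
      _ ≤ ‖x‖ * (‖act M‖ * ‖act M.transpose x‖) := by gcongr; exact (act M).le_opNorm _
      _ = _ := by ring
  exact le_of_mul_le_mul_right h1 h

theorem act_ne_zero {a b : ℕ} {M : Matrix (Fin a) (Fin b) ℝ} (hM : M ≠ 0) : act M ≠ 0 := by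
  intro h
  apply hM
  have h1 : Matrix.toEuclideanLin M = 0 :=
    LinearMap.toContinuousLinearMap.map_eq_zero_iff.1 h
  exact (LinearEquiv.map_eq_zero_iff _).1 h1

namespace Problem

variable {n m q : ℕ} (P : Problem n m q)

/-! ### Best responses and the real values of `Q`, `θ₀`, `θ_φ` -/

/-- The real value of `Q(x, y, l)`, meaningful for `y` in the domain of `ψ`. -/
def Qr (x : E n) (y : E m) (l : E q) : ℝ :=
  inner ℝ x (act P.K y) - P.h y + inner ℝ l (P.resid x y) - (P.ψ y).toReal

/-- `y₀` maximizes `Q(x, ·, l)`, with the quadratic decay that `μ`-strong concavity entails. -/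
def IsBest (μ : ℝ) (x : E n) (l : E q) (y₀ : E m) : Prop :=
  P.ψ y₀ ≠ ⊤ ∧ ∀ y, P.ψ y ≠ ⊤ → P.Qr x y l + μ / 2 * ‖y - y₀‖ ^ 2 ≤ P.Qr x y₀ l

/-- The best response `argmax_y Q(x, y, l)`. -/
def best (μ : ℝ) (x : E n) (l : E q) : E m := Classical.epsilon (P.IsBest μ x l)

variable {P} {Lg Lh μ : ℝ}

theorem best_spec (hP : Assumptions P Lg Lh μ) (x : E n) (l : E q) :
    P.IsBest μ x l (P.best μ x l) := by
  refine Classical.epsilon_spec (p := P.IsBest μ x l) ?_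
  obtain ⟨p, hp0, hp⟩ := exists_strong_minimizer hP.ψ_proper hP.ψ_lsc
    (k := fun y => P.h y - inner ℝ x (act P.K y) - inner ℝ l (P.resid x y))
    (by
      have := hP.h_smooth.continuous
      unfold resid
      fun_prop) hP.μ_pos (by
      intro z w s t hs ht hst hz hw
      obtain ⟨h1, -⟩ := hP.ψ_convex.toReal_le hP.ψ_proper hs ht hst hz hw
      refine ⟨h1, ?_⟩
      have h2 := hP.strong z w s t hs ht hst
      simp only [] at h2
      rw [← EReal.coe_toReal hz (hP.ψ_proper.1 z), ← EReal.coe_toReal hw (hP.ψ_proper.1 w),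
        ← EReal.coe_toReal h1 (hP.ψ_proper.1 _)] at h2
      norm_cast at h2
      have e1 : P.resid x (s • z + t • w) = s • P.resid x z + t • P.resid x w := by
        have e2 : act P.A x + P.c = (s + t) • (act P.A x + P.c) := by rw [hst, one_smul]
        simp only [resid, map_add, map_smul]
        calc act P.A x + (s • act P.B z + t • act P.B w) + P.c
            = (act P.A x + P.c) + (s • act P.B z + t • act P.B w) := by abel
          _ = _ := by rw [e2]; module
      rw [e1]
      simp only [map_add, map_smul, inner_add_right, inner_smul_right]
      linarith)
  refine ⟨p, hp0, fun y hy => ?_⟩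
  have := hp y hy
  simp only [Qr]
  linarith

theorem Q_eq_coe (hP : Assumptions P Lg Lh μ) (x : E n) {y : E m} (l : E q) (hy : P.ψ y ≠ ⊤) :
    P.Q x y l = (P.Qr x y l : EReal) := by
  rw [Q, Qr, EReal.coe_sub _ (P.ψ y).toReal, EReal.coe_toReal hy (hP.ψ_proper.1 y)]

theorem Q_eq_bot (x : E n) {y : E m} (l : E q) (hy : P.ψ y = ⊤) : P.Q x y l = ⊥ := by
  rw [Q, hy, EReal.sub_top]

theorem θ₀_eq (hP : Assumptions P Lg Lh μ) {x : E n} {l : E q} {y₀ : E m}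
    (h : P.IsBest μ x l y₀) : P.θ₀ x l = (P.Qr x y₀ l : EReal) := by
  apply le_antisymm
  · refine iSup_le fun y => ?_
    by_cases hy : P.ψ y = ⊤
    · rw [Q_eq_bot x l hy]; exact bot_le
    · rw [Q_eq_coe hP x l hy, EReal.coe_le_coe_iff]
      have h1 := h.2 y hy
      have h2 := hP.μ_pos
      have : 0 ≤ μ / 2 * ‖y - y₀‖ ^ 2 := by positivity
      linarith
  · rw [← Q_eq_coe hP x l h.1]
    exact le_iSup (fun y => P.Q x y l) y₀

variable (P) in
/-- The real value of `θ_φ(x, l)`, meaningful for `x` in the domain of `φ`. -/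
def θr (μ : ℝ) (x : E n) (l : E q) : ℝ :=
  (P.φ x).toReal + P.g x + P.Qr x (P.best μ x l) l

theorem θφ_eq_coe (hP : Assumptions P Lg Lh μ) {x : E n} (l : E q) (hx : P.φ x ≠ ⊤) :
    P.θφ x l = (P.θr μ x l : EReal) := by
  rw [θφ, θr, θ₀_eq hP (best_spec hP x l), EReal.coe_add, EReal.coe_add,
    EReal.coe_toReal hx (hP.φ_proper.1 x)]

theorem θφ_eq_top (hP : Assumptions P Lg Lh μ) {x : E n} (l : E q) (hx : P.φ x = ⊤) :
    P.θφ x l = ⊤ := by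
  rw [θφ, θ₀_eq hP (best_spec hP x l), hx, EReal.top_add_coe, EReal.top_add_coe]

/-! ### The inner loop -/

/-- One inner step contracts the squared distance to the best response. The modulus `κ` of `h`
itself may be `0`. -/
theorem innerStep_contract (hP : Assumptions P Lg Lh μ) {κ : ℝ}
    (hκ : StrongConvexOn Set.univ κ P.h) {α : ℝ} (hα : 0 < α) (hαL : α * Lh ≤ 1)
    {x : E n} {l : E q} {y₀ : E m} (h : P.IsBest μ x l y₀) (y : E m) :
    (1 + μ * α) * ‖P.innerStep α x l y - y₀‖ ^ 2 ≤ (1 - κ * α) * ‖y - y₀‖ ^ 2 := by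
  have h1 := prox_gradient_step hP.ψ_proper hP.ψ_lsc hP.ψ_convex
    (hP.h_smooth.differentiable one_ne_zero) hP.h_lip hκ hα hαL
    (act P.K.transpose x + act P.B.transpose l) y y₀ h.1 (y' := P.innerStep α x l y)
    (by rw [innerStep, add_assoc])
  have h2 := h.2 (P.innerStep α x l y)
    (prox_spec hP.ψ_proper hP.ψ_lsc hP.ψ_convex hα _).1
  simp only [Qr, resid, inner_add_right, inner_act] at h2
  simp only [inner_add_left] at h1
  rw [norm_sub_rev y₀, norm_sub_rev y₀] at h1
  have h3 := mul_le_mul_of_nonneg_left h2 hα.le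
  linarith

/-- The rate `-log (1 - μ α)` is that of a number in `(0, 1)`: the modulus `μ` of `h` is at most
`L_h`, because the space of `y` is nontrivial. -/
theorem one_sub_modulus_pos (hP : Assumptions P Lg Lh μ) (hB : P.B ≠ 0) {α : ℝ} (hα : 0 < α)
    (hαL : α * Lh < 1) (hsc : StrongConvexOn Set.univ μ P.h) : 0 < 1 - μ * α := by
  obtain ⟨d, hd⟩ : ∃ d : E m, d ≠ 0 := by
    by_contra! hcon
    apply act_ne_zero hB
    ext1 v
    rw [hcon v, map_zero, map_zero]
  have hle := strong_modulus_le (hP.h_smooth.differentiable one_ne_zero) hP.h_lip hsc hd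
  nlinarith

/-- `N` inner steps contract the squared distance to the best response by `exp (-r N)`. -/
theorem innerLoop_contract (hP : Assumptions P Lg Lh μ) (hB : P.B ≠ 0) {α : ℝ} (hα : 0 < α)
    (hαL : α * Lh < 1) {r : ℝ} (hr : P.IsInnerRate μ α r)
    {x : E n} {l : E q} {y₀ : E m} (h : P.IsBest μ x l y₀) (y : E m) (N : ℕ) :
    ‖(P.innerStep α x l)^[N] y - y₀‖ ^ 2 ≤ Real.exp (-(r * N)) * ‖y - y₀‖ ^ 2 := by
  have hμ := hP.μ_pos
  have hstep : ∀ y, ‖P.innerStep α x l y - y₀‖ ^ 2 ≤ Real.exp (-r) * ‖y - y₀‖ ^ 2 := by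
    intro y
    rcases hr with rfl | ⟨hsc, rfl⟩
    · have h1 := innerStep_contract hP (strongConvexOn_zero.2 hP.h_convex) hα hαL.le h y
      rw [zero_mul, sub_zero, one_mul] at h1
      rw [Real.exp_neg, Real.exp_log (by positivity), inv_mul_eq_div, le_div_iff₀ (by positivity)]
      linarith
    · have h0 := one_sub_modulus_pos hP hB hα hαL hsc
      have h1 := innerStep_contract hP hsc hα hαL.le h y
      rw [neg_neg, Real.exp_log h0]
      have h2 : 0 ≤ μ * α * ‖P.innerStep α x l y - y₀‖ ^ 2 := by positivity
      linarith
  induction N with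
  | zero => simp
  | succ N ih =>
    rw [Function.iterate_succ_apply']
    refine (hstep _).trans ?_
    calc Real.exp (-r) * ‖(P.innerStep α x l)^[N] y - y₀‖ ^ 2
        ≤ Real.exp (-r) * (Real.exp (-(r * N)) * ‖y - y₀‖ ^ 2) := by gcongr
      _ = _ := by rw [← mul_assoc, ← Real.exp_add]; push_cast; ring_nf

theorem innerStep_nonexpansive (hP : Assumptions P Lg Lh μ) {α : ℝ} (hα : 0 < α)
    (hαL : α * Lh ≤ 1) {x : E n} {l : E q} {y₀ : E m} (h : P.IsBest μ x l y₀) (y : E m) :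
    ‖P.innerStep α x l y - y₀‖ ≤ ‖y - y₀‖ := by
  have h1 := innerStep_contract hP (strongConvexOn_zero.2 hP.h_convex) hα hαL h y
  have hμ := hP.μ_pos
  have h2 : 0 ≤ μ * α * ‖P.innerStep α x l y - y₀‖ ^ 2 := by positivity
  exact (sq_le_sq₀ (norm_nonneg _) (norm_nonneg _)).1 (by linarith)

/-! ### Elementary consequences of the step size bound -/

theorem γ_sq_ge_left (Lg μ : ℝ) :
    2 * (Lg * μ + ‖act P.K‖ ^ 2) ^ 2 + 2 * (‖act P.A‖ * μ + ‖act P.K‖ * ‖act P.B‖) ^ 2 ≤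
      P.γ Lg μ ^ 2 := by
  refine (Real.sqrt_le_left (le_max_of_le_left (Real.sqrt_nonneg _))).1 ?_
  exact le_max_left _ _

theorem γ_sq_ge_right (Lg μ : ℝ) :
    2 * (‖act P.A‖ * μ + ‖act P.K‖ * ‖act P.B‖) ^ 2 + 2 * (‖act P.B‖ ^ 2) ^ 2 ≤
      P.γ Lg μ ^ 2 := by
  refine (Real.sqrt_le_left (le_max_of_le_left (Real.sqrt_nonneg _))).1 ?_
  refine le_of_eq_of_le ?_ (le_max_right _ _)
  congr 1
  ring

theorem γ_pos (hB : P.B ≠ 0) : 0 < P.γ Lg μ := by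
  have hb : 0 < ‖act P.B‖ := norm_pos_iff.2 (act_ne_zero hB)
  refine lt_max_of_lt_right (Real.sqrt_pos.2 ?_)
  positivity

end Problem

/-! ### Scalar estimates for one outer step -/

/-- A symmetric `2 × 2` quadratic form is bounded by the row norms of its matrix. -/
theorem quadratic_form_le {p s w G : ℝ} (hG : 0 ≤ G) (h1 : 2 * p ^ 2 + 2 * s ^ 2 ≤ G ^ 2)
    (h2 : 2 * s ^ 2 + 2 * w ^ 2 ≤ G ^ 2) (a b : ℝ) :
    p * a ^ 2 + 2 * s * a * b + w * b ^ 2 ≤ G * (a ^ 2 + b ^ 2) := by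
  have e : p * a ^ 2 + 2 * s * a * b + w * b ^ 2 = a * (p * a + s * b) + b * (s * a + w * b) := by
    ring
  refine (le_abs_self _).trans (abs_le_of_sq_le_sq ?_ (by positivity))
  have h3 : (a * (p * a + s * b) + b * (s * a + w * b)) ^ 2 ≤
      (a ^ 2 + b ^ 2) * ((p * a + s * b) ^ 2 + (s * a + w * b) ^ 2) := by
    nlinarith [sq_nonneg (a * (s * a + w * b) - b * (p * a + s * b))]
  have h4 : (p * a + s * b) ^ 2 + (s * a + w * b) ^ 2 ≤ G ^ 2 * (a ^ 2 + b ^ 2) := by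
    have h5 := mul_le_mul_of_nonneg_right h1 (sq_nonneg a)
    have h6 := mul_le_mul_of_nonneg_right h2 (sq_nonneg b)
    nlinarith [sq_nonneg (p * a - s * b), sq_nonneg (s * a - w * b)]
  rw [e]
  calc _ ≤ _ := h3
    _ ≤ (a ^ 2 + b ^ 2) * (G ^ 2 * (a ^ 2 + b ^ 2)) := by gcongr
    _ = _ := by ring

/-- `(k a + β b)² ≤ (k² + β²) (a² + b²)`. -/
theorem sq_add_le_mul (k β a b : ℝ) : (k * a + β * b) ^ 2 ≤ (k ^ 2 + β ^ 2) * (a ^ 2 + b ^ 2) := by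
  nlinarith [sq_nonneg (k * b - β * a)]

/-- Young's inequality for the error term of an inexact gradient step with step size `α`. -/
theorem young_error {α : ℝ} (hα : 0 < α) (k β a b e : ℝ) :
    (k * a + β * b) * e ≤
      1 / (2 * α) * (a ^ 2 + b ^ 2) + α / 2 * ((k ^ 2 + β ^ 2) * e ^ 2) := by
  have h1 := sq_add_le_mul (k * e) (β * e) a b
  have e1 : 1 / (2 * α) * (a ^ 2 + b ^ 2) + α / 2 * ((k ^ 2 + β ^ 2) * e ^ 2) =
      ((a ^ 2 + b ^ 2) / α + α * ((k ^ 2 + β ^ 2) * e ^ 2)) / 2 := by field_simp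
  rw [e1, le_div_iff₀ two_pos]
  refine (le_abs_self _).trans (abs_le_of_sq_le_sq ?_ (by positivity))
  have e2 : (a ^ 2 + b ^ 2) / α * (α * ((k ^ 2 + β ^ 2) * e ^ 2)) =
      ((k * e) ^ 2 + (β * e) ^ 2) * (a ^ 2 + b ^ 2) := by field_simp
  have h2 := sq_nonneg ((a ^ 2 + b ^ 2) / α - α * ((k ^ 2 + β ^ 2) * e ^ 2))
  linarith

/-- Combination of the prox inequality `hp`, the descent lemma `hd` and the error bound `he` for
one inexact proximal gradient step; `A` and `B` are the squared lengths of the two parts of the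
step. -/
theorem descent_arith {α L A B w φ φ' g g' Q Q' i j k s : ℝ} (hα : 0 < α) (hc : 0 < 1 - α * L)
    (hL : 0 ≤ L) (hw : 0 ≤ w)
    (hp : α * φ' + 1 / 2 * (A + 2 * (α * i) + s) + 1 / 2 * A ≤ α * φ + 1 / 2 * s)
    (hd : g' + Q' ≤ g + Q + (i - j) + (-(1 / α) * B - k) + L / 2 * (A + B))
    (he : -j - k ≤ 1 / (2 * α) * (A + B) + α / 2 * w) :
    (A + B) / α ^ 2 ≤ 2 * (1 / (α * (1 - L * α))) * (φ + g + Q - (φ' + g' + Q')) +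
      w / (1 - α * L) ^ 2 := by
  have hp' : φ' + 1 / α * A + i ≤ φ := by
    have e : α * (φ' + 1 / α * A + i) = α * φ' + A + α * i := by field_simp
    refine le_of_mul_le_mul_left ?_ hα
    linarith
  rw [mul_comm L α]
  set c := 1 - α * L with hcdef
  have hc1 : c ≤ 1 := by
    have : 0 ≤ α * L := by positivity
    linarith
  set D := φ + g + Q - (φ' + g' + Q') with hD
  have main : c / (2 * α) * (A + B) ≤ D + α / 2 * w := by
    have e : c / (2 * α) * (A + B) = 1 / α * A + 1 / α * B
        - L / 2 * (A + B) - 1 / (2 * α) * (A + B) := by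
      rw [hcdef]; field_simp; ring
    linarith
  calc (A + B) / α ^ 2 = 2 / (α * c) * (c / (2 * α) * (A + B)) := by
        field_simp
    _ ≤ 2 / (α * c) * (D + α / 2 * w) := by gcongr
    _ = 2 * (1 / (α * c)) * D + w / c := by field_simp
    _ ≤ _ := by
        gcongr
        nlinarith

namespace Problem

variable {n m q : ℕ} {P : Problem n m q} {Lg Lh μ : ℝ}

/-! ### Descent of `θ_φ` along an outer step -/

theorem stepsize_mul_γ_lt (hB : P.B ≠ 0) {α : ℝ} (hα' : α < 1 / P.Lθ Lg μ) :
    α * P.γ Lg μ < μ := by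
  have hγ : 0 < P.γ Lg μ := γ_pos hB
  rwa [Lθ, one_div_div, lt_div_iff₀ hγ] at hα'

theorem one_sub_stepsize_pos (hμ : 0 < μ) (hB : P.B ≠ 0) {α : ℝ} (hα' : α < 1 / P.Lθ Lg μ) :
    0 < 1 - α * P.Lθ Lg μ := by
  have h := stepsize_mul_γ_lt hB hα'
  rw [Lθ, ← mul_div_assoc, sub_pos, div_lt_one hμ]
  exact h

theorem stepsize_sq_mul_γ_sq_le (hB : P.B ≠ 0) {α : ℝ} (hα : 0 < α)
    (hα' : α < 1 / P.Lθ Lg μ) : α ^ 2 * P.γ Lg μ ^ 2 ≤ μ ^ 2 := by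
  have h := stepsize_mul_γ_lt hB hα'
  have hγ : 0 < P.γ Lg μ := γ_pos hB
  rw [← mul_pow]
  gcongr

theorem stepsize_normA (hμ : 0 < μ) (hB : P.B ≠ 0) {α : ℝ} (hα : 0 < α)
    (hα' : α < 1 / P.Lθ Lg μ) : (α * ‖act P.A‖) ^ 2 ≤ 1 / 2 := by
  have h := stepsize_sq_mul_γ_sq_le hB hα hα'
  have h1 : 2 * (‖act P.A‖ * μ) ^ 2 ≤ P.γ Lg μ ^ 2 := by
    refine le_trans ?_ (γ_sq_ge_right Lg μ)
    have h2 : (‖act P.A‖ * μ) ^ 2 ≤ (‖act P.A‖ * μ + ‖act P.K‖ * ‖act P.B‖) ^ 2 := by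
      gcongr
      have : 0 ≤ ‖act P.K‖ * ‖act P.B‖ := by positivity
      linarith
    have h3 : 0 ≤ (‖act P.B‖ ^ 2) ^ 2 := by positivity
    linarith
  have h2 := mul_le_mul_of_nonneg_left h1 (sq_nonneg α)
  have h3 : μ ^ 2 * (2 * (α * ‖act P.A‖) ^ 2) ≤ μ ^ 2 * 1 := by nlinarith
  have h4 := le_of_mul_le_mul_left h3 (by positivity)
  linarith

theorem stepsize_normKB (hμ : 0 < μ) (hB : P.B ≠ 0) {α : ℝ} (hα : 0 < α)
    (hα' : α < 1 / P.Lθ Lg μ) :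
    α ^ 2 * (‖act P.K‖ ^ 2 + ‖act P.B‖ ^ 2) ≤ μ ^ 2 / ‖act P.B‖ ^ 2 := by
  have hb : 0 < ‖act P.B‖ := norm_pos_iff.2 (act_ne_zero hB)
  have h := stepsize_sq_mul_γ_sq_le hB hα hα'
  have h1 : (‖act P.K‖ ^ 2 + ‖act P.B‖ ^ 2) * ‖act P.B‖ ^ 2 ≤ P.γ Lg μ ^ 2 := by
    refine le_trans ?_ (γ_sq_ge_right Lg μ)
    have h2 : (‖act P.K‖ * ‖act P.B‖) ^ 2 ≤ (‖act P.A‖ * μ + ‖act P.K‖ * ‖act P.B‖) ^ 2 := by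
      gcongr
      have : 0 ≤ ‖act P.A‖ * μ := by positivity
      linarith
    have h3 : 0 ≤ (‖act P.B‖ ^ 2) ^ 2 := by positivity
    have h4 : 0 ≤ (‖act P.K‖ * ‖act P.B‖) ^ 2 := by positivity
    nlinarith
  rw [le_div_iff₀ (by positivity)]
  have h2 := mul_le_mul_of_nonneg_left h1 (sq_nonneg α)
  linarith

/-- The descent lemma for `g + θ₀` with constant `L_θ`, obtained by comparing the two best
responses; differentiability of `θ₀` is not needed. -/
theorem smooth_part_descent (hP : Assumptions P Lg Lh μ) {x x' : E n} {l l' : E q}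
    {y₀ y₁ : E m} (h₀ : P.IsBest μ x l y₀) (h₁ : P.IsBest μ x' l' y₁) :
    P.g x' + P.Qr x' y₁ l' ≤ P.g x + P.Qr x y₀ l
      + inner ℝ (x' - x) (gradient P.g x + act P.K y₀ + act P.A.transpose l)
      + inner ℝ (l' - l) (P.resid x y₀)
      + P.Lθ Lg μ / 2 * (‖x' - x‖ ^ 2 + ‖l' - l‖ ^ 2) := by
  have hμ := hP.μ_pos
  have hg := descent_lemma (hP.g_smooth.differentiable one_ne_zero) hP.g_lip x x'
  have hq := h₀.2 y₁ h₁.1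
  set dx := x' - x with hdx
  set dl := l' - l with hdl
  set e := y₁ - y₀ with he
  have hx' : x' = x + dx := by rw [hdx]; abel
  have hl' : l' = l + dl := by rw [hdl]; abel
  have hy : y₁ = y₀ + e := by rw [he]; abel
  have e1 : P.Qr x' y₁ l' - P.Qr x y₁ l = inner ℝ dx (act P.K y₀ + act P.A.transpose l)
      + inner ℝ dl (P.resid x y₀) + inner ℝ dl (act P.A dx)
      + (inner ℝ dx (act P.K e) + inner ℝ dl (act P.B e)) := by
    have e2 : inner ℝ dx (act P.A.transpose l) = inner ℝ l (act P.A dx) := by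
      rw [inner_act, real_inner_comm, Matrix.transpose_transpose]
    simp only [inner_add_right, e2]
    simp only [Qr, resid, hx', hl', hy, map_add, inner_add_left, inner_add_right]
    ring
  set a := ‖dx‖
  set b := ‖dl‖
  have b1 : inner ℝ dl (act P.A dx) ≤ ‖act P.A‖ * a * b := by
    calc inner ℝ dl (act P.A dx) ≤ ‖dl‖ * ‖act P.A dx‖ := real_inner_le_norm _ _
      _ ≤ b * (‖act P.A‖ * a) := by gcongr; exact (act P.A).le_opNorm _
      _ = _ := by ring
  have b2 : inner ℝ dx (act P.K e) ≤ ‖act P.K‖ * a * ‖e‖ := by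
    calc inner ℝ dx (act P.K e) ≤ ‖dx‖ * ‖act P.K e‖ := real_inner_le_norm _ _
      _ ≤ a * (‖act P.K‖ * ‖e‖) := by gcongr; exact (act P.K).le_opNorm _
      _ = _ := by ring
  have b3 : inner ℝ dl (act P.B e) ≤ ‖act P.B‖ * b * ‖e‖ := by
    calc inner ℝ dl (act P.B e) ≤ ‖dl‖ * ‖act P.B e‖ := real_inner_le_norm _ _
      _ ≤ b * (‖act P.B‖ * ‖e‖) := by gcongr; exact (act P.B).le_opNorm _
      _ = _ := by ring
  have b4 : (‖act P.K‖ * a + ‖act P.B‖ * b) * ‖e‖ ≤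
      μ / 2 * ‖e‖ ^ 2 + (‖act P.K‖ * a + ‖act P.B‖ * b) ^ 2 / (2 * μ) := by
    rw [← sub_nonneg]
    have : μ / 2 * ‖e‖ ^ 2 + (‖act P.K‖ * a + ‖act P.B‖ * b) ^ 2 / (2 * μ) -
        (‖act P.K‖ * a + ‖act P.B‖ * b) * ‖e‖ =
        (μ * ‖e‖ - (‖act P.K‖ * a + ‖act P.B‖ * b)) ^ 2 / (2 * μ) := by field_simp; ring
    rw [this]
    positivity
  have hquad := quadratic_form_le (G := P.γ Lg μ) (le_max_of_le_left (Real.sqrt_nonneg _))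
    (γ_sq_ge_left (P := P) Lg μ) (γ_sq_ge_right Lg μ) a b
  have b5 : Lg / 2 * a ^ 2 + ‖act P.A‖ * a * b +
      (‖act P.K‖ * a + ‖act P.B‖ * b) ^ 2 / (2 * μ) ≤ P.Lθ Lg μ / 2 * (a ^ 2 + b ^ 2) := by
    have e3 : Lg / 2 * a ^ 2 + ‖act P.A‖ * a * b +
      (‖act P.K‖ * a + ‖act P.B‖ * b) ^ 2 / (2 * μ) =
      ((Lg * μ + ‖act P.K‖ ^ 2) * a ^ 2 + 2 * (‖act P.A‖ * μ + ‖act P.K‖ * ‖act P.B‖) * a * b +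
        ‖act P.B‖ ^ 2 * b ^ 2) / (2 * μ) := by field_simp; ring
    have e4 : P.Lθ Lg μ / 2 * (a ^ 2 + b ^ 2) = P.γ Lg μ * (a ^ 2 + b ^ 2) / (2 * μ) := by
      rw [Lθ]; field_simp
    rw [e3, e4]
    gcongr
  rw [add_assoc (gradient P.g x), inner_add_right dx (gradient P.g x),
    real_inner_comm (gradient P.g x)]
  linarith

/-- One outer step decreases `θ_φ` up to the error of the inner loop. -/
theorem outer_descent (hP : Assumptions P Lg Lh μ) (hB : P.B ≠ 0) {α : ℝ} (hα : 0 < α)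
    (hα' : α < 1 / P.Lθ Lg μ) {x x' : E n} {l l' : E q} {y : E m} (hx : P.φ x ≠ ⊤)
    (hx' : x' = prox α P.φ (x - α • (gradient P.g x + act P.K y + act P.A.transpose l)))
    (hl' : l' = l - α • P.resid x y) :
    (‖x' - x‖ ^ 2 + ‖l' - l‖ ^ 2) / α ^ 2 ≤
      2 * P.χ₀ Lg μ α * (P.θr μ x l - P.θr μ x' l')
        + P.χ₁ Lg μ α * ‖y - P.best μ x l‖ ^ 2 := by
  have h₀ := best_spec hP x l
  have h₁ := best_spec hP x' l'
  have hc := one_sub_stepsize_pos hP.μ_pos hB hα'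
  have hd := smooth_part_descent hP h₀ h₁
  have hL : 0 ≤ P.Lθ Lg μ := div_nonneg (γ_pos hB).le hP.μ_pos.le
  simp only [θr]
  set y₀ := P.best μ x l
  set y₁ := P.best μ x' l'
  set dx := x' - x with hdx
  set dl := l' - l with hdl
  set e := y - y₀ with he
  have hy : y₀ = y - e := by rw [he]; abel
  have hp := (prox_spec hP.φ_proper hP.φ_lsc hP.φ_convex hα
    (x - α • (gradient P.g x + act P.K y + act P.A.transpose l))).2 x hx
  rw [← hx'] at hp
  have e1 : x' - (x - α • (gradient P.g x + act P.K y + act P.A.transpose l)) =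
      dx + α • (gradient P.g x + act P.K y + act P.A.transpose l) := by rw [hdx]; abel
  rw [e1, sub_sub_cancel, norm_add_sq_real, inner_smul_right, norm_sub_rev x x', ← hdx] at hp
  have e2 : inner ℝ dx (gradient P.g x + act P.K y₀ + act P.A.transpose l) =
      inner ℝ dx (gradient P.g x + act P.K y + act P.A.transpose l) - inner ℝ dx (act P.K e) := by
    rw [hy, map_sub, ← inner_sub_right]
    congr 1
    abel
  have e3 : inner ℝ dl (P.resid x y₀) = -(1 / α) * ‖dl‖ ^ 2 - inner ℝ dl (act P.B e) := by
    have e4 : P.resid x y = -(1 / α) • dl := by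
      rw [hdl, hl', sub_sub_cancel_left, neg_smul_neg, smul_smul, one_div, inv_mul_cancel₀ hα.ne',
        one_smul]
    have e5 : P.resid x y₀ = P.resid x y - act P.B e := by
      simp only [resid, hy, map_sub]; abel
    rw [e5, inner_sub_right, e4, inner_smul_right, real_inner_self_eq_norm_sq]
  rw [e2, e3] at hd
  set a := ‖dx‖
  set b := ‖dl‖
  have b2 : -inner ℝ dx (act P.K e) ≤ ‖act P.K‖ * a * ‖e‖ := by
    rw [← inner_neg_left]
    calc inner ℝ (-dx) (act P.K e) ≤ ‖-dx‖ * ‖act P.K e‖ := real_inner_le_norm _ _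
      _ ≤ a * (‖act P.K‖ * ‖e‖) := by rw [norm_neg]; gcongr; exact (act P.K).le_opNorm _
      _ = _ := by ring
  have b3 : -inner ℝ dl (act P.B e) ≤ ‖act P.B‖ * b * ‖e‖ := by
    rw [← inner_neg_left]
    calc inner ℝ (-dl) (act P.B e) ≤ ‖-dl‖ * ‖act P.B e‖ := real_inner_le_norm _ _
      _ ≤ b * (‖act P.B‖ * ‖e‖) := by rw [norm_neg]; gcongr; exact (act P.B).le_opNorm _
      _ = _ := by ring
  have b4 : (‖act P.K‖ * a + ‖act P.B‖ * b) * ‖e‖ ≤ 1 / (2 * α) * (a ^ 2 + b ^ 2) +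
      α / 2 * ((‖act P.K‖ ^ 2 + ‖act P.B‖ ^ 2) * ‖e‖ ^ 2) :=
    young_error hα _ _ _ _ _
  have hw : P.χ₁ Lg μ α * ‖e‖ ^ 2 =
      (‖act P.K‖ ^ 2 + ‖act P.B‖ ^ 2) * ‖e‖ ^ 2 / (1 - α * P.Lθ Lg μ) ^ 2 := by
    rw [χ₁, div_mul_eq_mul_div]
  rw [hw]
  exact descent_arith hα hc hL (by positivity) hp hd (by linarith)

/-! ### The projection onto the constraint set -/

theorem isUnit_gram (hrank : (Matrix.fromCols P.A P.B).rank = q) :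
    IsUnit (P.A * P.A.transpose + P.B * P.B.transpose) := by
  have h1 : (P.A * P.A.transpose + P.B * P.B.transpose).rank = q := by
    rw [← Matrix.fromCols_mul_fromRows, ← Matrix.transpose_fromCols,
      Matrix.rank_self_mul_transpose, hrank]
  rw [← Matrix.linearIndependent_rows_iff_isUnit, linearIndependent_iff_card_eq_finrank_span,
    Set.finrank, ← Matrix.rank_eq_finrank_span_row, h1, Fintype.card_fin]

/-- The projection onto `{(x, y) : A x + B y + c = 0}` is
`(x - Aᵀ S⁻¹ r, y - Bᵀ S⁻¹ r)` with `S = A Aᵀ + B Bᵀ` and `r = A x + B y + c`. -/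
theorem projC_eq (hrank : (Matrix.fromCols P.A P.B).rank = q) (x : E n) (y : E m) :
    P.resid (P.projC (x, y)).1 (P.projC (x, y)).2 = 0 ∧
    P.projC (x, y) =
      (x - act (P.A.transpose * (P.A * P.A.transpose + P.B * P.B.transpose)⁻¹) (P.resid x y),
       y - act (P.B.transpose * (P.A * P.A.transpose + P.B * P.B.transpose)⁻¹) (P.resid x y)) := by
  have hgram : ∀ v, act P.A (act P.A.transpose v) + act P.B (act P.B.transpose v) =
      act (P.A * P.A.transpose + P.B * P.B.transpose) v := by
    intro v
    rw [← act_mul, ← act_mul]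
    simp [act_apply, Matrix.add_mulVec]
  have hS := isUnit_gram hrank
  have hSS : act (P.A * P.A.transpose + P.B * P.B.transpose)
      (act (P.A * P.A.transpose + P.B * P.B.transpose)⁻¹ (P.resid x y)) = P.resid x y := by
    rw [← act_mul, Matrix.mul_nonsing_inv _ ((Matrix.isUnit_iff_isUnit_det _).1 hS)]
    simp [act_apply]
  simp only [act_mul]
  set s := act (P.A * P.A.transpose + P.B * P.B.transpose)⁻¹ (P.resid x y) with hs
  have hSs : act P.A (act P.A.transpose s) + act P.B (act P.B.transpose s) = P.resid x y :=
    (hgram s).trans hSS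
  set w : E n × E m := (x - act P.A.transpose s, y - act P.B.transpose s) with hw
  have hwC : P.resid w.1 w.2 = 0 := by
    have : P.resid w.1 w.2 = P.resid x y -
        (act P.A (act P.A.transpose s) + act P.B (act P.B.transpose s)) := by
      simp only [hw, resid, map_sub]; abel
    rw [this, hSs, sub_self]
  -- Pythagoras: `z - w` is orthogonal to the direction space of the constraint set.
  have hpyth : ∀ u : E n × E m, P.resid u.1 u.2 = 0 →
      ‖x - u.1‖ ^ 2 + ‖y - u.2‖ ^ 2 =
        ‖x - w.1‖ ^ 2 + ‖y - w.2‖ ^ 2 + (‖w.1 - u.1‖ ^ 2 + ‖w.2 - u.2‖ ^ 2) := by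
    intro u hu
    have h1 : act P.A (w.1 - u.1) + act P.B (w.2 - u.2) = 0 := by
      have : act P.A (w.1 - u.1) + act P.B (w.2 - u.2) = P.resid w.1 w.2 - P.resid u.1 u.2 := by
        simp only [resid, map_sub]; abel
      rw [this, hwC, hu, sub_self]
    have h2 : inner ℝ (x - w.1) (w.1 - u.1) + inner ℝ (y - w.2) (w.2 - u.2) = 0 := by
      have e1 : x - w.1 = act P.A.transpose s := by simp only [hw]; abel
      have e2 : y - w.2 = act P.B.transpose s := by simp only [hw]; abel
      rw [e1, e2, ← inner_act, ← inner_act, ← inner_add_right, h1, inner_zero_right]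
    have e3 : x - u.1 = (x - w.1) + (w.1 - u.1) := by abel
    have e4 : y - u.2 = (y - w.2) + (w.2 - u.2) := by abel
    rw [e3, e4, norm_add_sq_real, norm_add_sq_real]
    linarith
  have hspec : P.IsProjC (x, y) (P.projC (x, y)) := by
    refine Classical.epsilon_spec (p := fun w => P.IsProjC (x, y) w) ⟨w, hwC, fun u hu => ?_⟩
    have := hpyth u hu
    have h3 : 0 ≤ ‖w.1 - u.1‖ ^ 2 + ‖w.2 - u.2‖ ^ 2 := by positivity
    simp only
    linarith
  refine ⟨hspec.1, ?_⟩
  have h1 := hspec.2 w hwC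
  have h2 := hpyth _ hspec.1
  simp only at h1
  generalize P.projC (x, y) = p at *
  have h3 := sq_nonneg ‖w.1 - p.1‖
  have h4 := sq_nonneg ‖w.2 - p.2‖
  have h5 : ‖w.1 - p.1‖ ^ 2 = 0 := by linarith
  have h6 : ‖w.2 - p.2‖ ^ 2 = 0 := by linarith
  rw [pow_eq_zero_iff two_ne_zero, norm_eq_zero, sub_eq_zero] at h5 h6
  exact (Prod.ext h5 h6).symm

/-! ### The gradient mappings at the projected iterate -/

/-- The gradient mapping in `x` at any point `(xt, yt)`, where `x'` comes from `(x, y, l)` by the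
outer step: `x'` is itself a proximal point, so nonexpansiveness applies to it. -/
theorem Gφ_norm_le (hP : Assumptions P Lg Lh μ) {α : ℝ} (hα : 0 < α) {x x' xt : E n} {l l' : E q}
    {y yt : E m}
    (hx' : x' = prox α P.φ (x - α • (gradient P.g x + act P.K y + act P.A.transpose l))) :
    ‖P.Gφ α⁻¹ xt yt l'‖ ≤ α⁻¹ * ((1 + α * Lg) * ‖x' - x‖ + α * ‖act P.A‖ * ‖l' - l‖) +
      ((Lg + 2 * α⁻¹) * ‖xt - x'‖ + ‖act P.K‖ * ‖yt - y‖) := by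
  set zt := xt - α • (gradient P.g xt + act P.K yt + act P.A.transpose l') with hzt
  set z := x - α • (gradient P.g x + act P.K y + act P.A.transpose l) with hz
  have h1 : ‖x' - prox α P.φ zt‖ ≤ ‖z - zt‖ := by
    rw [hx']
    exact prox_nonexpansive hP.φ_proper hP.φ_lsc hP.φ_convex hα _ _
  have e1 : z - zt = α • (gradient P.g x' - gradient P.g x)
      + α • (gradient P.g xt - gradient P.g x') + α • act P.K (yt - y)
      + α • act P.A.transpose (l' - l) - (x' - x) - (xt - x') := by
    simp only [hz, hzt, map_sub]
    module
  have h2 : ‖z - zt‖ ≤ α * (Lg * ‖x' - x‖) + α * (Lg * ‖xt - x'‖) + α * (‖act P.K‖ * ‖yt - y‖) +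
      α * (‖act P.A‖ * ‖l' - l‖) + ‖x' - x‖ + ‖xt - x'‖ := by
    rw [e1]
    refine (norm_sub_le _ _).trans (add_le_add_left ((norm_sub_le _ _).trans (add_le_add_left
      (norm_add₄_le.trans ?_) _)) _)
    simp only [norm_smul, Real.norm_of_nonneg hα.le]
    gcongr
    · exact hP.g_lip _ _
    · exact hP.g_lip _ _
    · exact (act P.K).le_opNorm _
    · exact norm_act_transpose_apply_le _ _
  have h3 : ‖xt - prox α P.φ zt‖ ≤ ‖xt - x'‖ + ‖x' - prox α P.φ zt‖ :=
    norm_sub_le_norm_sub_add_norm_sub _ _ _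
  have h4 : ‖xt - prox α P.φ zt‖ ≤ (1 + α * Lg) * ‖x' - x‖ + α * ‖act P.A‖ * ‖l' - l‖ +
      ((2 + α * Lg) * ‖xt - x'‖ + α * ‖act P.K‖ * ‖yt - y‖) := by linarith
  rw [Gφ, inv_inv, ← hzt, norm_smul, Real.norm_of_nonneg (inv_nonneg.2 hα.le)]
  refine (mul_le_mul_of_nonneg_left h4 (inv_nonneg.2 hα.le)).trans (le_of_eq ?_)
  field_simp
  ring

/-- The gradient mapping in `y` at any point `(xt, yt)`: an inner step from `y` does
not increase the distance to the best response `y₀` to `(x, l)`, so it has length at most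
`2 ‖y - y₀‖`. -/
theorem Gψ_norm_le (hP : Assumptions P Lg Lh μ) {α : ℝ} (hα : 0 < α) (hαL : α * Lh ≤ 1)
    {x x' xt : E n} {l l' : E q} {y yt y₀ : E m} (h₀ : P.IsBest μ x l y₀) :
    ‖P.Gψ α⁻¹ xt yt l'‖ ≤ α⁻¹ * (2 * ‖y - y₀‖) +
      (‖act P.K‖ * ‖x' - x‖ + ‖act P.B‖ * ‖l' - l‖) +
      ((Lh + 2 * α⁻¹) * ‖yt - y‖ + ‖act P.K‖ * ‖xt - x'‖) := by
  set zt := yt + α • (-gradient P.h yt + act P.K.transpose xt + act P.B.transpose l') with hzt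
  set z := y + α • (-gradient P.h y + act P.K.transpose x + act P.B.transpose l) with hz
  have h1 : ‖prox α P.ψ z - prox α P.ψ zt‖ ≤ ‖z - zt‖ :=
    prox_nonexpansive hP.ψ_proper hP.ψ_lsc hP.ψ_convex hα _ _
  have e1 : z - zt = α • (gradient P.h yt - gradient P.h y) + α • act P.K.transpose (x - x')
      + α • act P.K.transpose (x' - xt) + α • act P.B.transpose (l - l') - (yt - y) := by
    simp only [hz, hzt, map_sub]
    module
  have h2 : ‖z - zt‖ ≤ α * (Lh * ‖yt - y‖) + α * (‖act P.K‖ * ‖x' - x‖) +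
      α * (‖act P.K‖ * ‖xt - x'‖) + α * (‖act P.B‖ * ‖l' - l‖) + ‖yt - y‖ := by
    rw [e1]
    refine (norm_sub_le _ _).trans (add_le_add_left (norm_add₄_le.trans ?_) _)
    simp only [norm_smul, Real.norm_of_nonneg hα.le]
    rw [norm_sub_rev x' x, norm_sub_rev xt x', norm_sub_rev l' l]
    gcongr
    · exact hP.h_lip _ _
    · exact norm_act_transpose_apply_le _ _
    · exact norm_act_transpose_apply_le _ _
    · exact norm_act_transpose_apply_le _ _
  have h3 : ‖prox α P.ψ z - y₀‖ ≤ ‖y - y₀‖ := innerStep_nonexpansive hP hα hαL h₀ y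
  have h4 : ‖yt - prox α P.ψ zt‖ ≤
      ‖yt - y‖ + ‖y - y₀‖ + ‖prox α P.ψ z - y₀‖ + ‖prox α P.ψ z - prox α P.ψ zt‖ := by
    have e2 : yt - prox α P.ψ zt = (yt - y) + (y - y₀) + (y₀ - prox α P.ψ z) +
        (prox α P.ψ z - prox α P.ψ zt) := by abel
    rw [e2, norm_sub_rev (prox α P.ψ z) y₀]
    exact norm_add₄_le
  have h5 : ‖yt - prox α P.ψ zt‖ ≤ 2 * ‖y - y₀‖ +
      α * (‖act P.K‖ * ‖x' - x‖ + ‖act P.B‖ * ‖l' - l‖) +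
      ((2 + α * Lh) * ‖yt - y‖ + α * ‖act P.K‖ * ‖xt - x'‖) := by linarith
  rw [Gψ, inv_inv, ← hzt, norm_smul, Real.norm_of_nonneg (inv_nonneg.2 hα.le)]
  refine (mul_le_mul_of_nonneg_left h5 (inv_nonneg.2 hα.le)).trans (le_of_eq ?_)
  field_simp
  ring

/-- The residual after an outer step is controlled by the length of the step. -/
theorem resid_sq_le (hμ : 0 < μ) (hB : P.B ≠ 0) {α : ℝ} (hα : 0 < α) (hα' : α < 1 / P.Lθ Lg μ)
    {x x' : E n} {l l' : E q} {y : E m} (hl' : l' = l - α • P.resid x y) :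
    ‖P.resid x' y‖ ^ 2 ≤ 3 / 2 * ((‖x' - x‖ ^ 2 + ‖l' - l‖ ^ 2) / α ^ 2) := by
  have e1 : P.resid x y = -(1 / α) • (l' - l) := by
    rw [hl', sub_sub_cancel_left, neg_smul_neg, smul_smul, one_div, inv_mul_cancel₀ hα.ne',
      one_smul]
  have e2 : P.resid x' y = P.resid x y + act P.A (x' - x) := by
    simp only [resid, map_sub]; abel
  have h1 : ‖P.resid x' y‖ ≤ (α * ‖act P.A‖) * (‖x' - x‖ / α) + 1 * (‖l' - l‖ / α) := by
    rw [e2, e1]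
    refine (norm_add_le _ _).trans ?_
    rw [norm_smul, norm_neg, Real.norm_of_nonneg (by positivity)]
    have h2 := (act P.A).le_opNorm (x' - x)
    have e3 : (α * ‖act P.A‖) * (‖x' - x‖ / α) = ‖act P.A‖ * ‖x' - x‖ := by field_simp
    rw [e3]
    have e4 : 1 / α * ‖l' - l‖ = 1 * (‖l' - l‖ / α) := by ring
    linarith
  have h2 := stepsize_normA hμ hB hα hα'
  calc ‖P.resid x' y‖ ^ 2 ≤ ((α * ‖act P.A‖) * (‖x' - x‖ / α) + 1 * (‖l' - l‖ / α)) ^ 2 := by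
        gcongr
    _ ≤ ((α * ‖act P.A‖) ^ 2 + 1 ^ 2) * ((‖x' - x‖ / α) ^ 2 + (‖l' - l‖ / α) ^ 2) :=
        sq_add_le_mul _ _ _ _
    _ ≤ (1 / 2 + 1 ^ 2) * ((‖x' - x‖ / α) ^ 2 + (‖l' - l‖ / α) ^ 2) := by gcongr
    _ = _ := by ring

/-- The gradient mappings at the projection of the new iterate, in terms of the squared scaled step
`U` and the error of the inner loop. -/
theorem gradient_mappings_sq_le (hP : Assumptions P Lg Lh μ)
    (hrank : (Matrix.fromCols P.A P.B).rank = q) (hB : P.B ≠ 0) {αx αy : ℝ} (hαx : 0 < αx)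
    (hαx' : αx < 1 / P.Lθ Lg μ) (hαy : 0 < αy) (hαy' : αy * Lh ≤ 1)
    {x x' : E n} {l l' : E q} {y y₀ : E m} (h₀ : P.IsBest μ x l y₀)
    (hx' : x' = prox αx P.φ (x - αx • (gradient P.g x + act P.K y + act P.A.transpose l)))
    (hl' : l' = l - αx • P.resid x y) {U : ℝ}
    (hU : U = (‖x' - x‖ ^ 2 + ‖l' - l‖ ^ 2) / αx ^ 2) :
    ‖P.Gφ αx⁻¹ (P.projC (x', y)).1 (P.projC (x', y)).2 l'‖ ^ 2 ≤
        4 * ((1 + αx * Lg) ^ 2 + 3 * P.ωx Lg αx ^ 2) * U ∧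
    ‖P.Gψ αy⁻¹ (P.projC (x', y)).1 (P.projC (x', y)).2 l'‖ ^ 2 ≤
        6 * (9 / αy ^ 2 * ‖y - y₀‖ ^ 2 + (μ ^ 2 / ‖act P.B‖ ^ 2 + 2 * P.ωy Lh αy ^ 2) * U) := by
  have hμ := hP.μ_pos
  have hLg := hP.Lg_pos
  have hLh := hP.Lh_pos
  have hU0 : 0 ≤ U := by rw [hU]; positivity
  have hρ := resid_sq_le hμ hB hαx hαx' (x' := x') hl'
  rw [← hU] at hρ
  set ρ := ‖P.resid x' y‖ with hρdef
  obtain ⟨-, hproj⟩ := projC_eq hrank x' y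
  have hxt : ‖(P.projC (x', y)).1 - x'‖ ≤ P.normA * ρ := by
    rw [hproj, sub_sub_cancel_left, norm_neg]
    exact (act _).le_opNorm _
  have hyt : ‖(P.projC (x', y)).2 - y‖ ≤ P.normB * ρ := by
    rw [hproj, sub_sub_cancel_left, norm_neg]
    exact (act _).le_opNorm _
  generalize (P.projC (x', y)).1 = xt at *
  generalize (P.projC (x', y)).2 = yt at *
  have hUab : U = (αx⁻¹ * ‖x' - x‖) ^ 2 + (αx⁻¹ * ‖l' - l‖) ^ 2 := by
    rw [hU]; field_simp
  constructor
  · have h1 := Gφ_norm_le hP hαx hx' (xt := xt) (yt := yt) (l' := l')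
    have h2 : (Lg + 2 * αx⁻¹) * ‖xt - x'‖ + ‖act P.K‖ * ‖yt - y‖ ≤ P.ωx Lg αx * ρ := by
      calc _ ≤ (Lg + 2 * αx⁻¹) * (P.normA * ρ) + ‖act P.K‖ * (P.normB * ρ) := by gcongr
        _ = _ := by rw [ωx]; ring
    set v := αx⁻¹ * ((1 + αx * Lg) * ‖x' - x‖ + αx * ‖act P.A‖ * ‖l' - l‖) with hv
    have h3 : v ^ 2 ≤ 3 / 2 * (1 + αx * Lg) ^ 2 * U := by
      have e : v = (1 + αx * Lg) * (αx⁻¹ * ‖x' - x‖) + αx * ‖act P.A‖ * (αx⁻¹ * ‖l' - l‖) := by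
        rw [hv]; ring
      have h4 := sq_add_le_mul (1 + αx * Lg) (αx * ‖act P.A‖) (αx⁻¹ * ‖x' - x‖) (αx⁻¹ * ‖l' - l‖)
      rw [← e, ← hUab] at h4
      have h5 := stepsize_normA hμ hB hαx hαx'
      have h6 : 1 ≤ (1 + αx * Lg) ^ 2 := by
        have : 0 ≤ αx * Lg := by positivity
        nlinarith
      refine h4.trans ?_
      gcongr
      linarith
    have h4 : ‖P.Gφ αx⁻¹ xt yt l'‖ ^ 2 ≤ (v + P.ωx Lg αx * ρ) ^ 2 := by
      gcongr
      linarith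
    have h5 : P.ωx Lg αx ^ 2 * ρ ^ 2 ≤ P.ωx Lg αx ^ 2 * (3 / 2 * U) := by gcongr
    have h6 : 0 ≤ (1 + αx * Lg) ^ 2 * U := by positivity
    have h7 : 0 ≤ P.ωx Lg αx ^ 2 * U := by positivity
    linarith [sq_nonneg (v - P.ωx Lg αx * ρ)]
  · have h1 := Gψ_norm_le hP hαy hαy' h₀ (x' := x') (l' := l') (y := y) (xt := xt) (yt := yt)
    have h2 : (Lh + 2 * αy⁻¹) * ‖yt - y‖ + ‖act P.K‖ * ‖xt - x'‖ ≤ P.ωy Lh αy * ρ := by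
      calc _ ≤ (Lh + 2 * αy⁻¹) * (P.normB * ρ) + ‖act P.K‖ * (P.normA * ρ) := by gcongr
        _ = _ := by rw [ωy]; ring
    set v := ‖act P.K‖ * ‖x' - x‖ + ‖act P.B‖ * ‖l' - l‖ with hv
    have h3 : v ^ 2 ≤ μ ^ 2 / ‖act P.B‖ ^ 2 * U := by
      have h4 := sq_add_le_mul ‖act P.K‖ ‖act P.B‖ ‖x' - x‖ ‖l' - l‖
      have e : ‖x' - x‖ ^ 2 + ‖l' - l‖ ^ 2 = αx ^ 2 * U := by rw [hU]; field_simp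
      rw [← hv, e] at h4
      calc v ^ 2 ≤ _ := h4
        _ = αx ^ 2 * (‖act P.K‖ ^ 2 + ‖act P.B‖ ^ 2) * U := by ring
        _ ≤ _ := by gcongr; exact stepsize_normKB hμ hB hαx hαx'
    set d := αy⁻¹ * (2 * ‖y - y₀‖) with hd
    have h4 : ‖P.Gψ αy⁻¹ xt yt l'‖ ^ 2 ≤ (d + v + P.ωy Lh αy * ρ) ^ 2 := by
      gcongr
      linarith
    have h5 : P.ωy Lh αy ^ 2 * ρ ^ 2 ≤ P.ωy Lh αy ^ 2 * (3 / 2 * U) := by gcongr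
    have h6 : d ^ 2 = 4 * (1 / αy ^ 2 * ‖y - y₀‖ ^ 2) := by rw [hd]; field_simp; ring
    have h7 : 0 ≤ P.ωy Lh αy ^ 2 * U := by positivity
    have h8 : 0 ≤ 1 / αy ^ 2 * ‖y - y₀‖ ^ 2 := by positivity
    have h9 : 0 ≤ μ ^ 2 / ‖act P.B‖ ^ 2 * U := by positivity
    have e9 : 9 / αy ^ 2 * ‖y - y₀‖ ^ 2 = 9 * (1 / αy ^ 2 * ‖y - y₀‖ ^ 2) := by ring
    rw [e9]
    have h10 : (d + v + P.ωy Lh αy * ρ) ^ 2 ≤ 3 * (d ^ 2 + v ^ 2 + (P.ωy Lh αy * ρ) ^ 2) := by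
      linarith [sq_nonneg (d - v), sq_nonneg (v - P.ωy Lh αy * ρ),
        sq_nonneg (d - P.ωy Lh αy * ρ)]
    linarith

end Problem

/-! ### Step counts -/

theorem InnerEnough.mul_exp_le {r a ε : ℝ} {N : ℕ} (h : InnerEnough r a ε N) (hr : 0 < r)
    (ha : 0 < a) (hε : 0 < ε) : a * Real.exp (-(r * N)) ≤ ε ^ 2 := by
  rw [InnerEnough, one_div_mul_eq_div, div_le_iff₀ hr, one_div, Real.log_inv] at h
  calc a * Real.exp (-(r * N)) = Real.exp (Real.log a + -(r * N)) := by
        rw [Real.exp_add, Real.exp_log ha]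
    _ ≤ Real.exp (Real.log ε + Real.log ε) := Real.exp_le_exp.2 (by linarith)
    _ = ε ^ 2 := by rw [Real.exp_add, Real.exp_log hε, sq]

/-- The least admissible numbers of inner and outer steps obey the stated complexity bounds. -/
theorem complexityBounds_ceil {r a C : ℝ} (hr : 0 < r) (hC : 0 ≤ C) :
    ComplexityBounds
      (fun ε => max 1 ⌈1 / r * (Real.log a + 2 * Real.log (1 / ε))⌉₊)
      (fun ε => max 1 ⌈C / ε ^ 2⌉₊) := by
  have hev : ∀ᶠ ε in 𝓝[>] (0 : ℝ), 0 < ε ∧ ε < 1 ∧ 1 ≤ Real.log ε⁻¹ := by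
    filter_upwards [Ioo_mem_nhdsGT (Real.exp_pos (-1))] with ε hε
    have h1 : Real.log ε ≤ -1 := ((Real.log_lt_iff_lt_exp hε.1).2 hε.2).le
    refine ⟨hε.1, hε.2.trans (Real.exp_zero ▸ Real.exp_lt_exp.2 (by norm_num)), ?_⟩
    rw [Real.log_inv]
    linarith
  have hN : (fun ε : ℝ =>
      ((max 1 ⌈1 / r * (Real.log a + 2 * Real.log (1 / ε))⌉₊ : ℕ) : ℝ) + 1)
      =O[𝓝[>] (0 : ℝ)] fun ε => Real.log ε⁻¹ := by
    refine IsBigO.of_bound (3 + |1 / r * Real.log a| + 2 / r) ?_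
    filter_upwards [hev] with ε ⟨_, _, h1⟩
    rw [Real.norm_of_nonneg (by positivity), Real.norm_of_nonneg (by linarith), one_div ε]
    set w := 1 / r * (Real.log a + 2 * Real.log ε⁻¹) with hw
    have h2 : w ≤ |1 / r * Real.log a| + 2 / r * Real.log ε⁻¹ := by
      have e : w = 1 / r * Real.log a + 2 / r * Real.log ε⁻¹ := by rw [hw]; ring
      rw [e]
      linarith [le_abs_self (1 / r * Real.log a)]
    have h3 : 0 ≤ |1 / r * Real.log a| + 2 / r * Real.log ε⁻¹ := by positivity
    have h4 : ((max 1 ⌈w⌉₊ : ℕ) : ℝ) ≤ |1 / r * Real.log a| + 2 / r * Real.log ε⁻¹ + 1 := by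
      rw [Nat.cast_max, Nat.cast_one]
      refine max_le (by linarith) ?_
      exact (Nat.cast_le.2 (Nat.ceil_mono h2)).trans (Nat.ceil_lt_add_one h3).le
    have h5 := mul_le_mul_of_nonneg_left h1 (abs_nonneg (1 / r * Real.log a))
    linarith
  have hT : (fun ε : ℝ => ((max 1 ⌈C / ε ^ 2⌉₊ : ℕ) : ℝ)) =O[𝓝[>] (0 : ℝ)] fun ε => ε⁻¹ ^ 2 := by
    refine IsBigO.of_bound (C + 1) ?_
    filter_upwards [hev] with ε ⟨h0, h1, _⟩
    rw [Real.norm_of_nonneg (by positivity), Real.norm_of_nonneg (by positivity)]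
    have h2 : 0 ≤ C / ε ^ 2 := by positivity
    have h3 : (1 : ℝ) ≤ ε⁻¹ ^ 2 := one_le_pow₀ ((one_le_inv₀ h0).2 h1.le)
    have e : C / ε ^ 2 = C * ε⁻¹ ^ 2 := by rw [inv_pow, div_eq_mul_inv]
    rw [Nat.cast_max, Nat.cast_one]
    refine max_le (by linarith) ?_
    have h4 := (Nat.ceil_lt_add_one h2).le
    linarith
  refine ⟨?_, hT, ?_⟩
  · refine IsBigO.trans (IsBigO.of_norm_le fun ε => ?_) hN
    rw [Real.norm_of_nonneg (by positivity)]
    linarith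
  · exact hT.mul hN

namespace Problem

variable {n m q : ℕ} {P : Problem n m q} {Lg Lh μ : ℝ}

theorem innerRate_pos (hP : Assumptions P Lg Lh μ) (hB : P.B ≠ 0) {α : ℝ} (hα : 0 < α)
    (hαL : α * Lh < 1) {r : ℝ} (hr : P.IsInnerRate μ α r) : 0 < r := by
  have hμ := hP.μ_pos
  have h0 : 0 < μ * α := by positivity
  rcases hr with rfl | ⟨hsc, rfl⟩
  · exact Real.log_pos (by linarith)
  · exact neg_pos.2 (Real.log_neg (one_sub_modulus_pos hP hB hα hαL hsc) (by linarith))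

theorem infθφ_eq_coe (hP : Assumptions P Lg Lh μ) (hinf : ⊥ < P.infθφ) :
    P.infθφ = (P.infθφ.toReal : EReal) := by
  obtain ⟨x, hx⟩ := hP.φ_proper.2
  refine (EReal.coe_toReal (fun h => ?_) hinf.ne').symm
  have h1 : P.infθφ ≤ P.θφ x 0 := iInf₂_le (f := fun x l => P.θφ x l) x 0
  rw [h, θφ_eq_coe hP 0 hx, top_le_iff] at h1
  exact EReal.coe_ne_top _ h1

theorem infθφ_le (hP : Assumptions P Lg Lh μ) (hinf : ⊥ < P.infθφ) {x : E n} (l : E q)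
    (hx : P.φ x ≠ ⊤) : P.infθφ.toReal ≤ P.θr μ x l := by
  rw [← EReal.coe_le_coe_iff, ← infθφ_eq_coe hP hinf, ← θφ_eq_coe hP l hx]
  exact iInf₂_le (f := fun x l => P.θφ x l) x l

theorem γ₂_pos (hP : Assumptions P Lg Lh μ) (hB : P.B ≠ 0) {αx : ℝ} (αy : ℝ) (hαx : 0 < αx)
    (hαx' : αx < 1 / P.Lθ Lg μ) : 0 < P.γ₂ Lg Lh μ αx αy := by
  have hμ := hP.μ_pos
  have hb : 0 < ‖act P.B‖ := norm_pos_iff.2 (act_ne_zero hB)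
  have hc := one_sub_stepsize_pos hμ hB hαx'
  have hχ : 0 < P.χ₀ Lg μ αx := by
    rw [χ₀, mul_comm (P.Lθ Lg μ)]
    positivity
  exact lt_max_of_lt_left (by positivity)

theorem γ₁_pos (Lg Lh μ αx : ℝ) {αy : ℝ} (hαy : 0 < αy) : 0 < P.γ₁ Lg Lh μ αx αy := by
  have hχ : 0 ≤ P.χ₁ Lg μ αx := by unfold χ₁; positivity
  exact lt_max_of_lt_left (by positivity)

/-- The requirement on the number of outer iterations, in terms of real numbers. -/
theorem outerEnough_iff (hP : Assumptions P Lg Lh μ) (hinf : ⊥ < P.infθφ) (hB : P.B ≠ 0)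
    {αx αy : ℝ} (hαx : 0 < αx) (hαx' : αx < 1 / P.Lθ Lg μ) {ε : ℝ} (hε : 0 < ε)
    (s₀ : E n × E m × E q) (T : ℕ) :
    P.OuterEnough Lg Lh μ αx αy ε s₀ T ↔ P.φ s₀.1 ≠ ⊤ ∧
      2 * P.γ₂ Lg Lh μ αx αy * (P.θr μ s₀.1 s₀.2.2 - P.infθφ.toReal) / ε ^ 2 ≤ T := by
  have hγ := γ₂_pos hP hB αy hαx hαx'
  rw [OuterEnough, infθφ_eq_coe hP hinf, EReal.toReal_coe]
  by_cases hx : P.φ s₀.1 = ⊤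
  · rw [θφ_eq_top hP _ hx, EReal.top_sub_coe, EReal.coe_mul_top_of_pos (by positivity)]
    exact iff_of_false (fun h => EReal.coe_ne_top _ (top_le_iff.1 h)) fun h => h.1 hx
  · rw [θφ_eq_coe hP _ hx, ← EReal.coe_sub, ← EReal.coe_mul, EReal.coe_le_coe_iff,
      div_mul_eq_mul_div]
    simp [hx]

/-! ### The run of the method -/

section Run

variable (αx αy : ℝ) (N : ℕ) (s₀ : E n × E m × E q)

theorem iter_succ (t : ℕ) : P.iter αx αy N s₀ (t + 1) =
    P.outerStep αx αy N (P.iter αx αy N s₀ t) :=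
  Function.iterate_succ_apply' _ _ _

variable {αx αy s₀}

theorem φ_iter_ne_top (hP : Assumptions P Lg Lh μ) (hαx : 0 < αx) (h0 : P.φ s₀.1 ≠ ⊤) (t : ℕ) :
    P.φ (P.iter αx αy N s₀ t).1 ≠ ⊤ := by
  cases t with
  | zero => exact h0
  | succ t =>
    rw [iter_succ]
    exact (prox_spec hP.φ_proper hP.φ_lsc hP.φ_convex hαx _).1

theorem norm_iter_le (hP : Assumptions P Lg Lh μ) (hαy : 0 < αy) (hN : 1 ≤ N) {β : ℝ}
    (hβ : ∀ y, P.ψ y ≠ ⊤ → ‖y‖ ≤ β) (h0 : ‖s₀.2.1‖ ≤ β) (t : ℕ) :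
    ‖(P.iter αx αy N s₀ t).2.1‖ ≤ β := by
  cases t with
  | zero => exact h0
  | succ t =>
    rw [iter_succ]
    obtain ⟨N, rfl⟩ : ∃ k, N = k + 1 := ⟨N - 1, by omega⟩
    apply hβ
    simp only [outerStep, Function.iterate_succ_apply']
    exact (prox_spec hP.ψ_proper hP.ψ_lsc hP.ψ_convex hαy _).1

/-- If the inner loops reach the squared accuracy `δ`, some projected iterate among the first `T`
is `ε`-stationary. -/
theorem exists_epsStationary (hP : Assumptions P Lg Lh μ) (hinf : ⊥ < P.infθφ)
    (hrank : (Matrix.fromCols P.A P.B).rank = q) (hB : P.B ≠ 0) (hαx : 0 < αx)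
    (hαx' : αx < 1 / P.Lθ Lg μ) (hαy : 0 < αy) (hαy' : αy * Lh ≤ 1) {ε : ℝ} (hε : 0 < ε)
    {T : ℕ} (hT : 1 ≤ T) {δ : ℝ}
    (hδ : ∀ t < T, ‖(P.iter αx αy N s₀ (t + 1)).2.1 -
      P.best μ (P.iter αx αy N s₀ t).1 (P.iter αx αy N s₀ t).2.2‖ ^ 2 ≤ δ)
    (hγδ : P.γ₁ Lg Lh μ αx αy * δ ≤ ε ^ 2 / 2)
    (hout : P.OuterEnough Lg Lh μ αx αy ε s₀ T) :
    ∃ t < T, P.EpsStationaryWith ε αx⁻¹ αy⁻¹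
      (P.projIter αx αy N s₀ (t + 1)).1 (P.projIter αx αy N s₀ (t + 1)).2
      (P.iter αx αy N s₀ (t + 1)).2.2 := by
  obtain ⟨hφ0, hout⟩ := (outerEnough_iff hP hinf hB hαx hαx' hε s₀ T).1 hout
  have hμ := hP.μ_pos
  have hc := one_sub_stepsize_pos hμ hB hαx'
  have hT0 : (0 : ℝ) < T := by exact_mod_cast hT
  have hδ0 : 0 ≤ δ := (sq_nonneg _).trans (hδ 0 hT)
  have hχ₀ : 0 < P.χ₀ Lg μ αx := by
    rw [χ₀, mul_comm (P.Lθ Lg μ)]; positivity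
  have hχ₁ : 0 ≤ P.χ₁ Lg μ αx := by unfold χ₁; positivity
  let s : ℕ → E n × E m × E q := P.iter αx αy N s₀
  let θ : ℕ → ℝ := fun t => P.θr μ (s t).1 (s t).2.2
  let U : ℕ → ℝ := fun t =>
    (‖(s (t + 1)).1 - (s t).1‖ ^ 2 + ‖(s (t + 1)).2.2 - (s t).2.2‖ ^ 2) / αx ^ 2
  set gap : ℝ := P.θr μ s₀.1 s₀.2.2 - P.infθφ.toReal with hgap
  have hgap0 : 0 ≤ gap := sub_nonneg.2 (infθφ_le hP hinf _ hφ0)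
  have hstep : ∀ t, (s (t + 1)).1 = prox αx P.φ ((s t).1 - αx • (gradient P.g (s t).1 +
      act P.K (s (t + 1)).2.1 + act P.A.transpose (s t).2.2)) ∧
      (s (t + 1)).2.2 = (s t).2.2 - αx • P.resid (s t).1 (s (t + 1)).2.1 := by
    intro t
    simp only [s, iter_succ]
    exact ⟨rfl, rfl⟩
  have hU : ∀ t ∈ Finset.range T, U t ≤
      2 * P.χ₀ Lg μ αx * (θ t - θ (t + 1)) + P.χ₁ Lg μ αx * δ := by
    intro t ht
    refine (outer_descent hP hB hαx hαx' (φ_iter_ne_top N hP hαx hφ0 t) (hstep t).1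
      (hstep t).2).trans ?_
    have := hδ t (Finset.mem_range.1 ht)
    simp only [θ, s]
    gcongr
  have hsum : ∑ t ∈ Finset.range T, U t ≤
      ∑ t ∈ Finset.range T, (2 * P.χ₀ Lg μ αx * gap / T + P.χ₁ Lg μ αx * δ) := by
    refine (Finset.sum_le_sum hU).trans ?_
    rw [Finset.sum_add_distrib, ← Finset.mul_sum, Finset.sum_range_sub', Finset.sum_add_distrib]
    have h1 : θ 0 - θ T ≤ gap := by
      have := infθφ_le hP hinf (P.iter αx αy N s₀ T).2.2 (φ_iter_ne_top (αy := αy) N hP hαx hφ0 T)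
      exact sub_le_sub_left this _
    have e : ∑ t ∈ Finset.range T, 2 * P.χ₀ Lg μ αx * gap / T = 2 * P.χ₀ Lg μ αx * gap := by
      rw [Finset.sum_const, Finset.card_range, nsmul_eq_mul]
      field_simp
    rw [e]
    gcongr
  -- One index serves both gradient mappings, since both are bounded through the same `U t`.
  obtain ⟨t, ht, hUt⟩ := Finset.exists_le_of_sum_le (Finset.nonempty_range_iff.2 (by omega)) hsum
  rw [Finset.mem_range] at ht
  refine ⟨t, ht, ?_⟩
  obtain ⟨h1, h2⟩ := gradient_mappings_sq_le hP hrank hB hαx hαx' hαy hαy'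
    (best_spec hP (s t).1 (s t).2.2) (hstep t).1 (hstep t).2 (U := U t) rfl
  have hd : ‖(s (t + 1)).2.1 - P.best μ (s t).1 (s t).2.2‖ ^ 2 ≤ δ := hδ t ht
  have hγ₂ : P.γ₂ Lg Lh μ αx αy * gap / T ≤ ε ^ 2 / 2 := by
    rw [div_le_iff₀ (by positivity)] at hout ⊢
    linarith
  have hsplit : ∀ κ : ℝ, 0 ≤ κ → κ * U t ≤
      κ * (2 * P.χ₀ Lg μ αx) * gap / T + κ * P.χ₁ Lg μ αx * δ := by
    intro κ hκ
    refine (mul_le_mul_of_nonneg_left hUt hκ).trans (le_of_eq ?_)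
    ring
  refine ⟨?_, ?_, (projC_eq hrank _ _).1⟩
  · refine (sq_le_sq₀ (norm_nonneg _) hε.le).1 (h1.trans ?_)
    refine (hsplit _ (by positivity)).trans ?_
    have h3 : 4 * ((1 + αx * Lg) ^ 2 + 3 * P.ωx Lg αx ^ 2) * (2 * P.χ₀ Lg μ αx) * gap / T ≤
        P.γ₂ Lg Lh μ αx αy * gap / T := by
      gcongr
      exact (le_of_eq (by ring)).trans (le_max_right _ _)
    have h4 : 4 * ((1 + αx * Lg) ^ 2 + 3 * P.ωx Lg αx ^ 2) * P.χ₁ Lg μ αx * δ ≤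
        P.γ₁ Lg Lh μ αx αy * δ := by
      gcongr
      refine le_trans ?_ (le_max_right _ _)
      have : 0 ≤ P.χ₁ Lg μ αx * ((1 + αx * Lg) ^ 2 + 3 * P.ωx Lg αx ^ 2) := by positivity
      linarith
    linarith
  · refine (sq_le_sq₀ (norm_nonneg _) hε.le).1 (h2.trans ?_)
    have hs := hsplit (6 * (μ ^ 2 / ‖act P.B‖ ^ 2 + 2 * P.ωy Lh αy ^ 2)) (by positivity)
    have h3 : 6 * (μ ^ 2 / ‖act P.B‖ ^ 2 + 2 * P.ωy Lh αy ^ 2) * (2 * P.χ₀ Lg μ αx) * gap / T ≤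
        P.γ₂ Lg Lh μ αx αy * gap / T := by
      gcongr
      exact (le_of_eq (by ring)).trans (le_max_left _ _)
    have h4 : 6 * (9 / αy ^ 2) * δ +
        6 * (μ ^ 2 / ‖act P.B‖ ^ 2 + 2 * P.ωy Lh αy ^ 2) * P.χ₁ Lg μ αx * δ ≤
        P.γ₁ Lg Lh μ αx αy * δ := by
      rw [← add_mul]
      gcongr
      refine le_trans ?_ (le_max_left _ _)
      have h5 : 0 ≤ μ ^ 2 / ‖act P.B‖ ^ 2 * P.χ₁ Lg μ αx := by positivity
      have h6 : 0 ≤ P.χ₁ Lg μ αx * P.ωy Lh αy ^ 2 := by positivity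
      have e : 2 * μ ^ 2 / ‖act P.B‖ ^ 2 * P.χ₁ Lg μ αx =
        2 * (μ ^ 2 / ‖act P.B‖ ^ 2 * P.χ₁ Lg μ αx) := by ring
      rw [e]
      linarith
    have h7 : 6 * (9 / αy ^ 2) * ‖(s (t + 1)).2.1 - P.best μ (s t).1 (s t).2.2‖ ^ 2 ≤
        6 * (9 / αy ^ 2) * δ := by gcongr
    linarith

/-- The accuracy of an inner loop, from a bound on its initial error. -/
theorem iter_error_le (hP : Assumptions P Lg Lh μ) (hB : P.B ≠ 0) (hαy : 0 < αy)
    (hαy' : αy * Lh < 1) {r : ℝ} (hr : P.IsInnerRate μ αy r) {t : ℕ} {D : ℝ}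
    (hD : ‖(P.iter αx αy N s₀ t).2.1 -
      P.best μ (P.iter αx αy N s₀ t).1 (P.iter αx αy N s₀ t).2.2‖ ^ 2 ≤ D) :
    ‖(P.iter αx αy N s₀ (t + 1)).2.1 -
      P.best μ (P.iter αx αy N s₀ t).1 (P.iter αx αy N s₀ t).2.2‖ ^ 2 ≤
      Real.exp (-(r * N)) * D := by
  rw [iter_succ]
  refine (innerLoop_contract hP hB hαy hαy' hr (best_spec hP _ _) _ N).trans ?_
  gcongr

theorem initial_error_le_of_bounded (hP : Assumptions P Lg Lh μ) (hαy : 0 < αy) (hN : 1 ≤ N)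
    {β : ℝ} (hβ : ∀ y, P.ψ y ≠ ⊤ → ‖y‖ ≤ β) (h0 : ‖s₀.2.1‖ ≤ β) (t : ℕ) :
    ‖(P.iter αx αy N s₀ t).2.1 -
      P.best μ (P.iter αx αy N s₀ t).1 (P.iter αx αy N s₀ t).2.2‖ ^ 2 ≤ 4 * β ^ 2 := by
  have h1 := norm_iter_le (αx := αx) N hP hαy hN hβ h0 t
  have h2 := hβ _ (best_spec hP (P.iter αx αy N s₀ t).1 (P.iter αx αy N s₀ t).2.2).1
  have h3 := norm_sub_le (P.iter αx αy N s₀ t).2.1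
    (P.best μ (P.iter αx αy N s₀ t).1 (P.iter αx αy N s₀ t).2.2)
  calc _ ≤ (2 * β) ^ 2 := by gcongr; linarith
    _ = _ := by ring

theorem initial_error_le_of_gap (hP : Assumptions P Lg Lh μ) {T : ℕ} {ω : ℝ}
    (hgap : P.GapsBounded αx αy N s₀ T ω) {t : ℕ} (ht : t ≤ T) :
    ‖(P.iter αx αy N s₀ t).2.1 -
      P.best μ (P.iter αx αy N s₀ t).1 (P.iter αx αy N s₀ t).2.2‖ ^ 2 ≤ 2 * ω / μ := by
  have hμ := hP.μ_pos
  have h1 := hgap t ht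
  generalize P.iter αx αy N s₀ t = s at *
  have hb := best_spec hP s.1 s.2.2
  rw [θ₀_eq hP hb] at h1
  have hy : P.ψ s.2.1 ≠ ⊤ := by
    intro htop
    rw [Q_eq_bot _ _ htop, EReal.coe_sub_bot, top_le_iff] at h1
    exact EReal.coe_ne_top _ h1
  rw [Q_eq_coe hP _ _ hy, ← EReal.coe_sub, EReal.coe_le_coe_iff] at h1
  have h2 := hb.2 _ hy
  rw [le_div_iff₀ hμ]
  linarith

end Run

end Problem

end LCMinimax

end

theorem theorem5p2 {n m q : ℕ} (P : LCMinimax.Problem n m q) (Lg Lh μ : ℝ)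
    (hP : LCMinimax.Assumptions P Lg Lh μ)
    (hinf : ⊥ < P.infθφ)
    (hrank : (Matrix.fromCols P.A P.B).rank = q)
    (hB : P.B ≠ 0)
    (αx αy : ℝ)
    (hαx : 0 < αx) (hαx' : αx < 1 / P.Lθ Lg μ)
    (hαy : 0 < αy) (hαy' : αy < 1 / Lh)
    (r : ℝ) (hr : P.IsInnerRate μ αy r)
    (s₀ : LCMinimax.E n × LCMinimax.E m × LCMinimax.E q) :
    -- (i) bounded domain of `ψ`
    (∀ (β₁ : ℝ), 0 < β₁ → (∀ y, P.ψ y ≠ ⊤ → ‖y‖ ≤ β₁) → ‖s₀.2.1‖ ≤ β₁ →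
      ∀ (ε : ℝ), 0 < ε → ∀ (N T : ℕ), 1 ≤ N → 1 ≤ T →
        LCMinimax.InnerEnough r (8 * P.γ₁ Lg Lh μ αx αy * β₁ ^ 2) ε N →
        P.OuterEnough Lg Lh μ αx αy ε s₀ T →
        ∃ t < T, P.EpsStationaryWith ε αx⁻¹ αy⁻¹
          (P.projIter αx αy N s₀ (t + 1)).1 (P.projIter αx αy N s₀ (t + 1)).2
          (P.iter αx αy N s₀ (t + 1)).2.2) ∧
    -- (ii) bounded inner gaps
    (∀ (ω₁ : ℝ), 0 < ω₁ →
      ∀ (ε : ℝ), 0 < ε → ∀ (N T : ℕ), 1 ≤ N → 1 ≤ T →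
        P.GapsBounded αx αy N s₀ T ω₁ →
        LCMinimax.InnerEnough r (4 * P.γ₁ Lg Lh μ αx αy * ω₁ / μ) ε N →
        P.OuterEnough Lg Lh μ αx αy ε s₀ T →
        ∃ t < T, P.EpsStationaryWith ε αx⁻¹ αy⁻¹
          (P.projIter αx αy N s₀ (t + 1)).1 (P.projIter αx αy N s₀ (t + 1)).2
          (P.iter αx αy N s₀ (t + 1)).2.2) ∧
    -- (iii) complexity, bounded domain of `ψ`
    (∀ (β₁ : ℝ), 0 < β₁ → (∀ y, P.ψ y ≠ ⊤ → ‖y‖ ≤ β₁) → ‖s₀.2.1‖ ≤ β₁ → P.φ s₀.1 ≠ ⊤ →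
      ∃ N T : ℝ → ℕ, LCMinimax.ComplexityBounds N T ∧
        (∀ (ε : ℝ), 0 < ε → 1 ≤ N ε ∧ 1 ≤ T ε ∧
          LCMinimax.InnerEnough r (8 * P.γ₁ Lg Lh μ αx αy * β₁ ^ 2) ε (N ε) ∧
          P.OuterEnough Lg Lh μ αx αy ε s₀ (T ε)) ∧
        ∀ (ε : ℝ), 0 < ε → ∃ t < T ε, P.IsEpsStationary ε
          (P.projIter αx αy (N ε) s₀ (t + 1)).1 (P.projIter αx αy (N ε) s₀ (t + 1)).2) ∧
    -- (iv) complexity, bounded inner gaps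
    (∀ (ω₁ : ℝ), 0 < ω₁ → P.φ s₀.1 ≠ ⊤ →
      ∃ N T : ℝ → ℕ, LCMinimax.ComplexityBounds N T ∧
        (∀ (ε : ℝ), 0 < ε → 1 ≤ N ε ∧ 1 ≤ T ε ∧
          LCMinimax.InnerEnough r (4 * P.γ₁ Lg Lh μ αx αy * ω₁ / μ) ε (N ε) ∧
          P.OuterEnough Lg Lh μ αx αy ε s₀ (T ε)) ∧
        ∀ (ε : ℝ), 0 < ε → P.GapsBounded αx αy (N ε) s₀ (T ε) ω₁ →
          ∃ t < T ε, P.IsEpsStationary ε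
            (P.projIter αx αy (N ε) s₀ (t + 1)).1 (P.projIter αx αy (N ε) s₀ (t + 1)).2) := by
  have hμ := hP.μ_pos
  have hαyL : αy * Lh < 1 := (lt_div_iff₀ hP.Lh_pos).1 hαy'
  have hr0 := LCMinimax.Problem.innerRate_pos hP hB hαy hαyL hr
  have hγ₁ := LCMinimax.Problem.γ₁_pos (P := P) Lg Lh μ αx hαy
  have hi : ∀ (β₁ : ℝ), 0 < β₁ → (∀ y, P.ψ y ≠ ⊤ → ‖y‖ ≤ β₁) → ‖s₀.2.1‖ ≤ β₁ →
      ∀ (ε : ℝ), 0 < ε → ∀ (N T : ℕ), 1 ≤ N → 1 ≤ T →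
        LCMinimax.InnerEnough r (8 * P.γ₁ Lg Lh μ αx αy * β₁ ^ 2) ε N →
        P.OuterEnough Lg Lh μ αx αy ε s₀ T →
        ∃ t < T, P.EpsStationaryWith ε αx⁻¹ αy⁻¹
          (P.projIter αx αy N s₀ (t + 1)).1 (P.projIter αx αy N s₀ (t + 1)).2
          (P.iter αx αy N s₀ (t + 1)).2.2 := by
    intro β hβ hdom h0 ε hε N T hN hT hin hout
    refine LCMinimax.Problem.exists_epsStationary N hP hinf hrank hB hαx hαx' hαy hαyL.le hε hT
      (fun t _ => LCMinimax.Problem.iter_error_le N hP hB hαy hαyL hr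
        (LCMinimax.Problem.initial_error_le_of_bounded N hP hαy hN hdom h0 t)) ?_ hout
    have := hin.mul_exp_le hr0 (by positivity) hε
    linarith
  have hii : ∀ (ω₁ : ℝ), 0 < ω₁ →
      ∀ (ε : ℝ), 0 < ε → ∀ (N T : ℕ), 1 ≤ T →
        P.GapsBounded αx αy N s₀ T ω₁ →
        LCMinimax.InnerEnough r (4 * P.γ₁ Lg Lh μ αx αy * ω₁ / μ) ε N →
        P.OuterEnough Lg Lh μ αx αy ε s₀ T →
        ∃ t < T, P.EpsStationaryWith ε αx⁻¹ αy⁻¹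
          (P.projIter αx αy N s₀ (t + 1)).1 (P.projIter αx αy N s₀ (t + 1)).2
          (P.iter αx αy N s₀ (t + 1)).2.2 := by
    intro ω hω ε hε N T hT hgap hin hout
    refine LCMinimax.Problem.exists_epsStationary N hP hinf hrank hB hαx hαx' hαy hαyL.le hε hT
      (fun t ht => LCMinimax.Problem.iter_error_le N hP hB hαy hαyL hr
        (LCMinimax.Problem.initial_error_le_of_gap N hP hgap ht.le)) ?_ hout
    have h1 := hin.mul_exp_le hr0 (by positivity) hε
    have e : P.γ₁ Lg Lh μ αx αy * (Real.exp (-(r * N)) * (2 * ω / μ)) =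
        4 * P.γ₁ Lg Lh μ αx αy * ω / μ * Real.exp (-(r * N)) / 2 := by ring
    rw [e]
    linarith
  -- The least admissible numbers of steps.
  have hchoice : ∀ a : ℝ, P.φ s₀.1 ≠ ⊤ → ∃ N T : ℝ → ℕ, LCMinimax.ComplexityBounds N T ∧
      ∀ (ε : ℝ), 0 < ε → 1 ≤ N ε ∧ 1 ≤ T ε ∧ LCMinimax.InnerEnough r a ε (N ε) ∧
        P.OuterEnough Lg Lh μ αx αy ε s₀ (T ε) := by
    intro a hφ
    have hγ₂ := LCMinimax.Problem.γ₂_pos hP hB αy hαx hαx'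
    have hgap := sub_nonneg.2 (LCMinimax.Problem.infθφ_le hP hinf s₀.2.2 hφ)
    refine ⟨_, _, LCMinimax.complexityBounds_ceil (a := a) hr0
      (mul_nonneg (mul_nonneg zero_le_two hγ₂.le) hgap), fun ε hε => ⟨le_max_left _ _,
      le_max_left _ _, ?_, ?_⟩⟩
    · exact (Nat.le_ceil _).trans (Nat.cast_le.2 (le_max_right _ _))
    · rw [LCMinimax.Problem.outerEnough_iff hP hinf hB hαx hαx' hε]
      exact ⟨hφ, (Nat.le_ceil _).trans (Nat.cast_le.2 (le_max_right _ _))⟩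
  refine ⟨hi, fun ω hω ε hε N T _ => hii ω hω ε hε N T, ?_, ?_⟩
  · intro β hβ hdom h0 hφ
    obtain ⟨N, T, hc, hNT⟩ := hchoice (8 * P.γ₁ Lg Lh μ αx αy * β ^ 2) hφ
    refine ⟨N, T, hc, hNT, fun ε hε => ?_⟩
    obtain ⟨h1, h2, h3, h4⟩ := hNT ε hε
    obtain ⟨t, ht, hst⟩ := hi β hβ hdom h0 ε hε _ _ h1 h2 h3 h4
    exact ⟨t, ht, _, αx⁻¹, αy⁻¹, inv_pos.2 hαx, inv_pos.2 hαy, hst⟩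
  · intro ω hω hφ
    obtain ⟨N, T, hc, hNT⟩ := hchoice (4 * P.γ₁ Lg Lh μ αx αy * ω / μ) hφ
    refine ⟨N, T, hc, hNT, fun ε hε hgap => ?_⟩
    obtain ⟨-, h2, h3, h4⟩ := hNT ε hε
    obtain ⟨t, ht, hst⟩ := hii ω hω ε hε _ _ h2 hgap h3 h4
    exact ⟨t, ht, _, αx⁻¹, αy⁻¹, inv_pos.2 hαx, inv_pos.2 hαy, hst⟩
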